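/- **Theorem (Moufang–Noether charge algebra).** Let $G$ be an analytic Moufang loop of dimension $r$: a quasigroup with unit $e$, with $(ag)(ha)=a(gh)a$, that is a real analytic manifold with analytic multiplication and inversion. Fix analytic local coordinates $g^1,\dots,g^r$ around $e$ and put $$c^i_{jk}=\frac{\partial^2(ghg^{-1}h^{-1})^i}{\partial g^j\,\partial h^k}\Big|_{g=h=e},\qquad [x,y]^i=c^i_{jk}x^jy^k,$$ $$6d^p_{jkl}=c^p_{js}c^s_{kl}-c^p_{ks}c^s_{jl}+c^p_{sl}c^s_{jk}$$ (repeated indices are summed). Let $(S,T)$ be a differentiable birepresentation of $G$: differentiable maps $S,T:G\to GL_n(\mathbb C)$ with $S_e=T_e=1$, $T_gS_gS_h=S_{gh}T_g$ and $S_gT_gT_h=T_{hg}S_g$ for all $g,h\in G$. Let $S_j=\partial S_g/\partial g^j|_{g=e}$ and $T_j=\partial T_g/\partial g^j|_{g=e}$ be its generators. Let $D$ be a complex inner product space. By an operator on $D$ we mean a linear map $D\to D$ that has an adjoint $D\to D$. Let $u^A(\cdot,t)$ and $p^0_A(\cdot,t)$, $A=1,\dots,n$, be the canonical fields and momenta at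 time $t$: linear maps from $\mathcal S(\mathbb R^m)$ to the operators on $D$, with matrix elements that are tempered distributions, satisfying the canonical equal-time relations $$[u^A(\mathbf x,t),p^0_B(\mathbf y,t)]=i\delta^A_B\,\delta(\mathbf x-\mathbf y),\qquad [u^A(\mathbf x,t),u^B(\mathbf y,t)]=0=[p^0_A(\mathbf x,t),p^0_B(\mathbf y,t)],$$ where all brackets are commutators (bosonic fields) or all are anticommutators (fermionic fields). The products of fields at a point are defined by point splitting. Let $K_\nu(\mathbf x,\mathbf y)=\sum_k f_{\nu,k}(\mathbf x)g_{\nu,k}(\mathbf y)$ (finite sums, $f_{\nu,k},g_{\nu,k}\in\mathcal S(\mathbb R^m)$) be a sequence of kernels with $K_\nu\to\delta(\mathbf x-\mathbf y)$, in the sense that the integral operators with kernel $K_\nu$ and with the transposed kernel converge pointwise on $\mathcal S(\mathbb R^m)$, in its topology, to the identity. For a matrix $M$, the charge $-i\int p^0Mu\,d\mathbf x$ is said to exist and to equal the operator $Q$ on $D$ if $$\Big\langle\varphi,\,-i\iint p^0_A(\mathbf x,t)K_\nu(\mathbf x,\mathbf y)M^A_Bu^B(\mathbf y,t)\,d\mathbf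 x\,d\mathbf y\;\psi\Big\rangle\longrightarrow\langle\varphi,Q\psi\rangle\qquad(\nu\to\infty)$$ for all $\varphi,\psi\in D$. At a time $t$, suppose that the Moufang–Noether charges $$\sigma_j=-i\int p^0S_ju\,d\mathbf x,\qquad \tau_j=-i\int p^0T_ju\,d\mathbf x,\qquad j=1,\dots,r,$$ exist, and define the Yamagutian $Y_{jk}$ by $$[\sigma_j,\tau_k]=-Y_{jk}+\tfrac13c^p_{jk}\sigma_p-\tfrac13c^p_{jk}\tau_p .$$ Then $(\sigma,\tau)$ is a birepresentation of the tangent Mal'tsev algebra $\Gamma=(T_eG,[\cdot,\cdot])$ of $G$. That is, $[\cdot,\cdot]$ is anticommutative and satisfies the Mal'tsev identity $[J(x,y,z),x]=J(x,y,[x,z])$ with $J(x,y,z)=[x,[y,z]]+[y,[z,x]]+[z,[x,y]]$, and, for all indices, in addition to the defining relation of $Y_{jk}$, $$[\sigma_j,\sigma_k]=2Y_{jk}+\tfrac13c^p_{jk}\sigma_p+\tfrac23c^p_{jk}\tau_p,\qquad [\tau_j,\tau_k]=2Y_{jk}-\tfrac23c^p_{jk}\sigma_p-\tfrac13c^p_{jk}\tau_p,$$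 $$Y_{jk}+Y_{kj}=0,\qquad c^p_{jk}Y_{pl}+c^p_{kl}Y_{pj}+c^p_{lj}Y_{pk}=0,$$ $$[Y_{jk},\sigma_l]=d^p_{jkl}\sigma_p,\qquad [Y_{jk},\tau_l]=d^p_{jkl}\tau_p,$$ $$[Y_{jk},Y_{lq}]=d^p_{jkl}Y_{pq}+d^p_{jkq}Y_{lp}.$$ -/

import Mathlib

open scoped Manifold ContDiff SchwartzMap InnerProductSpace Matrix

noncomputable section

/-! ### Analytic Moufang loops and their tangent algebras -/

/-- A Moufang loop: a quasigroup with unit satisfying `(ag)(ha) = a(gh)a`, together with its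
(two-sided) inversion. -/
class MoufangLoop (G : Type*) extends Mul G, One G, Inv G where
  one_mul' : ∀ g : G, 1 * g = g
  mul_one' : ∀ g : G, g * 1 = g
  mul_left_bijective' : ∀ a : G, Function.Bijective fun g : G => a * g
  mul_right_bijective' : ∀ a : G, Function.Bijective fun g : G => g * a
  mul_inv' : ∀ g : G, g * g⁻¹ = 1
  inv_mul' : ∀ g : G, g⁻¹ * g = 1
  moufang' : ∀ a g h : G, (a * g) * (h * a) = (a * (g * h)) * a

/-- An analytic Moufang loop of dimension `r`: a Moufang loop that is a real analytic manifold
with analytic multiplication and inversion. -/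
class IsAnalyticMoufangLoop (r : ℕ) (G : Type*) [TopologicalSpace G]
    [ChartedSpace (EuclideanSpace ℝ (Fin r)) G] [MoufangLoop G] : Prop
    extends IsManifold (𝓡 r) ω G where
  contMDiff_mul' : ContMDiff ((𝓡 r).prod (𝓡 r)) (𝓡 r) ω fun q : G × G => q.1 * q.2
  contMDiff_inv' : ContMDiff (𝓡 r) (𝓡 r) ω fun g : G => g⁻¹

/-- The point of `G` whose coordinates in the chart `φ` are those of the unit, with the `j`-th
coordinate increased by `s`. -/
def coordPoint {r : ℕ} {G : Type*} [TopologicalSpace G] [One G]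
    (φ : OpenPartialHomeomorph G (EuclideanSpace ℝ (Fin r))) (j : Fin r) (s : ℝ) : G :=
  φ.symm (φ 1 + EuclideanSpace.single j s)

/-- The structure constant `c^i_{jk} = ∂²(g h g⁻¹ h⁻¹)^i / ∂g^j ∂h^k` at `g = h = e`, in the
local coordinates given by the chart `φ`. -/
def structureConstant {r : ℕ} {G : Type*} [TopologicalSpace G] [MoufangLoop G]
    (φ : OpenPartialHomeomorph G (EuclideanSpace ℝ (Fin r))) (i j k : Fin r) : ℝ :=
  deriv (fun s : ℝ => deriv (fun t : ℝ =>
    φ (coordPoint φ j s * coordPoint φ k t * (coordPoint φ j s)⁻¹ * (coordPoint φ k t)⁻¹) i) 0) 0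

/-- The product `[x, y]^i = c^i_{jk} x^j y^k` with given structure constants. -/
def bracketOf {r : ℕ} (c : Fin r → Fin r → Fin r → ℝ) (x y : Fin r → ℝ) : Fin r → ℝ :=
  fun i => ∑ j, ∑ k, c i j k * x j * y k

/-- The Jacobian `J(x,y,z) = [x,[y,z]] + [y,[z,x]] + [z,[x,y]]`. -/
def jacobian {V : Type*} [AddCommGroup V] (b : V → V → V) (x y z : V) : V :=
  b x (b y z) + b y (b z x) + b z (b x y)

/-- The anticommutative product `b` satisfies the Mal'tsev identity
`[J(x,y,z), x] = J(x, y, [x,z])`. -/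
structure IsMaltsevBracket {V : Type*} [AddCommGroup V] (b : V → V → V) : Prop where
  anticomm : ∀ x y, b x y = -b y x
  maltsev : ∀ x y z, b (jacobian b x y z) x = jacobian b x y (b x z)

/-! ### Birepresentations of Moufang loops -/

/-- `(S, T)` is a birepresentation of the Moufang loop `G`. -/
structure IsBirepresentation {n : ℕ} {G : Type*} [MoufangLoop G] (S T : G → GL (Fin n) ℂ) :
    Prop where
  left_one : S 1 = 1
  right_one : T 1 = 1
  left_mul : ∀ g h : G, T g * S g * S h = S (g * h) * T g
  right_mul : ∀ g h : G, S g * T g * T h = T (h * g) * S g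

/-- The matrix entries of `S : G → GL_n` are (real) differentiable functions on `G`. -/
def IsDifferentiableMap (r : ℕ) {n : ℕ} {G : Type*} [TopologicalSpace G]
    [ChartedSpace (EuclideanSpace ℝ (Fin r)) G] (S : G → GL (Fin n) ℂ) : Prop :=
  ∀ A B : Fin n, MDifferentiable (𝓡 r) 𝓘(ℝ, ℂ) fun g : G => (S g : Matrix (Fin n) (Fin n) ℂ) A B

/-- The generator `S_j = ∂S_g / ∂g^j` at `g = e`, in the coordinates given by the chart `φ`. -/
def generator {r n : ℕ} {G : Type*} [TopologicalSpace G] [One G]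
    (φ : OpenPartialHomeomorph G (EuclideanSpace ℝ (Fin r))) (S : G → GL (Fin n) ℂ) (j : Fin r) :
    Matrix (Fin n) (Fin n) ℂ :=
  Matrix.of fun A B => deriv (fun s : ℝ => (S (coordPoint φ j s) : Matrix (Fin n) (Fin n) ℂ) A B) 0

/-! ### Birepresentations of Mal'tsev algebras -/

/-- The Yamaguti constants,
`6 d^p_{jkl} = c^p_{js} c^s_{kl} - c^p_{ks} c^s_{jl} + c^p_{sl} c^s_{jk}`. -/
def yamagutiConstant {r : ℕ} (c : Fin r → Fin r → Fin r → ℝ) (p j k l : Fin r) : ℝ :=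
  (∑ s, (c p j s * c s k l - c p k s * c s j l + c p s l * c s j k)) / 6

/-- The Yamagutian of the pair `(σ, τ)`, i.e. the solution `Y_{jk}` of
`[σ_j, τ_k] = -Y_{jk} + (1/3) c^p_{jk} σ_p - (1/3) c^p_{jk} τ_p`. -/
def yamagutian {r : ℕ} {A : Type*} [Ring A] [Algebra ℂ A] (c : Fin r → Fin r → Fin r → ℝ)
    (σ τ : Fin r → A) (j k : Fin r) : A :=
  -⁅σ j, τ k⁆ + (1 / 3 : ℂ) • ∑ p, (c p j k : ℂ) • σ p - (1 / 3 : ℂ) • ∑ p, (c p j k : ℂ) • τ p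

/-- The families `σ`, `τ` of elements of an associative algebra form, with Yamaguti operators `Y`,
a birepresentation of the Mal'tsev algebra with structure constants `c`. -/
structure IsMaltsevBirepresentation {r : ℕ} {A : Type*} [Ring A] [Algebra ℂ A]
    (c : Fin r → Fin r → Fin r → ℝ) (σ τ : Fin r → A) (Y : Fin r → Fin r → A) : Prop where
  isMaltsev : IsMaltsevBracket (bracketOf c)
  comm_left_left : ∀ j k, ⁅σ j, σ k⁆ =
    (2 : ℂ) • Y j k + (1 / 3 : ℂ) • ∑ p, (c p j k : ℂ) • σ p
      + (2 / 3 : ℂ) • ∑ p, (c p j k : ℂ) • τ p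
  comm_left_right : ∀ j k, ⁅σ j, τ k⁆ =
    -Y j k + (1 / 3 : ℂ) • ∑ p, (c p j k : ℂ) • σ p
      - (1 / 3 : ℂ) • ∑ p, (c p j k : ℂ) • τ p
  comm_right_right : ∀ j k, ⁅τ j, τ k⁆ =
    (2 : ℂ) • Y j k - (2 / 3 : ℂ) • ∑ p, (c p j k : ℂ) • σ p
      - (1 / 3 : ℂ) • ∑ p, (c p j k : ℂ) • τ p
  yamaguti_antisymm : ∀ j k, Y j k + Y k j = 0
  yamaguti_cyclic : ∀ j k l,
    ∑ p, ((c p j k : ℂ) • Y p l + (c p k l : ℂ) • Y p j + (c p l j : ℂ) • Y p k) = 0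
  reductivity_left : ∀ j k l, ⁅Y j k, σ l⁆ = ∑ p, (yamagutiConstant c p j k l : ℂ) • σ p
  reductivity_right : ∀ j k l, ⁅Y j k, τ l⁆ = ∑ p, (yamagutiConstant c p j k l : ℂ) • τ p
  comm_yamaguti : ∀ j k l q, ⁅Y j k, Y l q⁆ =
    ∑ p, ((yamagutiConstant c p j k l : ℂ) • Y p q + (yamagutiConstant c p j k q : ℂ) • Y l p)

/-! ### Quantum fields at a fixed time and canonical equal-time relations

The operators act on a common invariant domain `D`, a complex inner product space (its completion
is the Hilbert space of states). -/

/-- The space `ℝ^m` of spatial positions, `m = d - 1`. -/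
abbrev Space (m : ℕ) : Type := EuclideanSpace ℝ (Fin m)

/-- The operator `A` on the domain `D` has an adjoint that is also defined on, and preserves,
`D`. -/
def HasAdjointOn {D : Type*} [NormedAddCommGroup D] [InnerProductSpace ℂ D]
    (A : Module.End ℂ D) : Prop :=
  ∃ B : Module.End ℂ D, ∀ x y : D, ⟪B x, y⟫_ℂ = ⟪x, A y⟫_ℂ

/-- A field on `ℝ^m` at a fixed time: an operator-valued tempered distribution
`f ↦ ∫ f(x) u(x) dx` on the invariant domain `D`. -/
structure OperatorField (m : ℕ) (D : Type*) [NormedAddCommGroup D] [InnerProductSpace ℂ D] where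
  smear : 𝓢(Space m, ℂ) →ₗ[ℂ] Module.End ℂ D
  hasAdjoint : ∀ f, HasAdjointOn (smear f)
  continuous_matrixElement : ∀ x y : D, Continuous fun f => ⟪x, smear f y⟫_ℂ

/-- The statistics of the fields. -/
inductive FieldStatistics
  | bosonic
  | fermionic

/-- The commutator for bosonic fields, the anticommutator for fermionic ones. -/
def FieldStatistics.bracket {A : Type*} [Ring A] : FieldStatistics → A → A → A
  | .bosonic, a, b => a * b - b * a
  | .fermionic, a, b => a * b + b * a

/-- The canonical equal-time relations for the fields `u^A` and their canonical momenta `p_A`, in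
smeared form: `[u^A(x), p_B(y)] = i δ^A_B δ(x - y)`, `[u^A(x), u^B(y)] = 0`,
`[p_A(x), p_B(y)] = 0`, with anticommutators in the fermionic case. -/
structure CanonicalETC {n m : ℕ} {D : Type*} [NormedAddCommGroup D] [InnerProductSpace ℂ D]
    (stat : FieldStatistics) (u p : Fin n → OperatorField m D) : Prop where
  field_momentum : ∀ (A B : Fin n) (f g : 𝓢(Space m, ℂ)),
    stat.bracket ((u A).smear f) ((p B).smear g) =
      (if A = B then Complex.I * ∫ x, f x * g x else 0) • (1 : Module.End ℂ D)
  field_field : ∀ (A B : Fin n) (f g : 𝓢(Space m, ℂ)),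
    stat.bracket ((u A).smear f) ((u B).smear g) = 0
  momentum_momentum : ∀ (A B : Fin n) (f g : 𝓢(Space m, ℂ)),
    stat.bracket ((p A).smear f) ((p B).smear g) = 0

/-! ### Charges

The product of `p` and `u` at the same point is defined by point splitting: `δ(x - y)` in
`∫ p(x) M u(x) dx = ∫∫ p(x) δ(x - y) M u(y) dx dy` is approximated by regular kernels. -/

/-- A regular kernel `∑_k f_k(x) g_k(y)` of finite rank. -/
structure SplittingKernel (m : ℕ) where
  rank : ℕ
  left : Fin rank → 𝓢(Space m, ℂ)
  right : Fin rank → 𝓢(Space m, ℂ)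

/-- The kernels `K ν` converge to `δ(x - y)`: the integral operators defined by `K ν` and by
its transpose converge to the identity, pointwise in the Schwartz space. -/
def IsDeltaSequence {m : ℕ} (K : ℕ → SplittingKernel m) : Prop :=
  ∀ h : 𝓢(Space m, ℂ),
    Filter.Tendsto (fun ν => ∑ k, (∫ y, (K ν).right k y * h y) • (K ν).left k)
      Filter.atTop (nhds h) ∧
    Filter.Tendsto (fun ν => ∑ k, (∫ x, (K ν).left k x * h x) • (K ν).right k)
      Filter.atTop (nhds h)

/-- The regularized charge `-i ∫∫ p_A(x) K(x, y) M^A_B u^B(y) dx dy`. -/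
def splitCharge {n m : ℕ} {D : Type*} [NormedAddCommGroup D] [InnerProductSpace ℂ D]
    (K : SplittingKernel m) (p : Fin n → OperatorField m D) (M : Matrix (Fin n) (Fin n) ℂ)
    (u : Fin n → OperatorField m D) : Module.End ℂ D :=
  (-Complex.I) • ∑ k, ∑ A, ∑ B,
    M A B • ((p A).smear (K.left k) * (u B).smear (K.right k))

/-- The operator `Q` on `D` (with adjoint on `D`) is the charge `-i ∫ p(x) M u(x) dx`: the limit,
in the sense of matrix elements, of the regularized charges. -/
def IsNoetherCharge {n m : ℕ} {D : Type*} [NormedAddCommGroup D] [InnerProductSpace ℂ D]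
    (K : ℕ → SplittingKernel m) (p : Fin n → OperatorField m D) (M : Matrix (Fin n) (Fin n) ℂ)
    (u : Fin n → OperatorField m D) (Q : Module.End ℂ D) : Prop :=
  HasAdjointOn Q ∧ ∀ x y : D,
    Filter.Tendsto (fun ν => ⟪x, splitCharge (K ν) p M u y⟫_ℂ) Filter.atTop (nhds ⟪x, Q y⟫_ℂ)

end

/-!
Differentiating the Moufang identities twice at the unit gives commutation relations between
infinitesimal left translations `S x` and right translations `T x`:
`[S x, S y] = S [x, y] - 2 [S x, T y]`, `[T x, T y] = -T [x, y] - 2 [S x, T y]` and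
`[S x, T y] = [T x, S y]`. They hold for the negatives of the translation vector fields of the loop
and for the generators of a birepresentation. By the Jacobi identity they imply the Yamagutian
relations and, as a translation vector field is determined by its value at the unit, the Mal'tsev
identity. The equal-time relations and the convergence of the splitting kernels turn
`M ↦ -i ∫ p M u` into a Lie algebra homomorphism, so that the charges inherit the relations from
the generators.
-/

noncomputable section

/-! ### The commutation relations of infinitesimal translations -/

/-- Abstract infinitesimal left and right translations `S`, `T` of a Moufang loop whose tangent
product is `b`: linear maps into a Lie algebra with the commutation relations obtained by
differentiating the Moufang identities twice at the unit. -/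
structure IsTranslationPair {𝕜 M L : Type*} [Field 𝕜] [AddCommGroup M] [Module 𝕜 M] [LieRing L]
    [LieAlgebra 𝕜 L] (b : M →ₗ[𝕜] M →ₗ[𝕜] M) (S T : M →ₗ[𝕜] L) : Prop where
  lie_left : ∀ x y, ⁅S x, S y⁆ = S (b x y) - (2 : 𝕜) • ⁅S x, T y⁆
  lie_right : ∀ x y, ⁅T x, T y⁆ = -T (b x y) - (2 : 𝕜) • ⁅S x, T y⁆
  lie_swap : ∀ x y, ⁅S x, T y⁆ = ⁅T x, S y⁆

theorem IsMaltsevBracket.of_injective {M N F : Type*} [AddCommGroup M] [AddCommGroup N]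
    [FunLike F M N] [AddMonoidHomClass F M N] {b : M → M → M} {b' : N → N → N}
    (h : IsMaltsevBracket b') (f : F) (hf : Function.Injective f)
    (hfb : ∀ x y, f (b x y) = b' (f x) (f y)) : IsMaltsevBracket b where
  anticomm x y := hf <| by rw [map_neg, hfb, hfb, h.anticomm]
  maltsev x y z := hf <| by
    simpa only [jacobian, hfb, map_add] using h.maltsev (f x) (f y) (f z)

section TripleProduct

variable {𝕜 M : Type*} [Field 𝕜] [AddCommGroup M] [Module 𝕜 M]

/-- The cyclic sum `[[x,y],z] + [[y,z],x] + [[z,x],y]`. -/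
def cyclicProduct (b : M →ₗ[𝕜] M →ₗ[𝕜] M) (x y z : M) : M :=
  b (b x y) z + b (b y z) x + b (b z x) y

/-- The Yamaguti triple product `(1/6) ([x,[y,z]] - [y,[x,z]] + [[x,y],z])`, whose structure
constants are `d^p_{jkl}`. -/
def tripleProduct (b : M →ₗ[𝕜] M →ₗ[𝕜] M) (x y z : M) : M :=
  (1 / 6 : 𝕜) • (b x (b y z) - b y (b x z) + b (b x y) z)

theorem cyclicProduct_rotate (b : M →ₗ[𝕜] M →ₗ[𝕜] M) (x y z : M) :
    cyclicProduct b y z x = cyclicProduct b x y z := by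
  unfold cyclicProduct
  abel

theorem cyclicProduct_neg (b : M →ₗ[𝕜] M →ₗ[𝕜] M) : cyclicProduct (-b) = cyclicProduct b := by
  funext x y z
  simp [cyclicProduct]

theorem tripleProduct_neg (b : M →ₗ[𝕜] M →ₗ[𝕜] M) : tripleProduct (-b) = tripleProduct b := by
  funext x y z
  simp [tripleProduct]

variable [CharZero 𝕜] {b : M →ₗ[𝕜] M →ₗ[𝕜] M}

theorem jacobian_add_two_smul_jacobian (hb : ∀ x y, b x y = -b y x)
    (hd : ∀ x y z w, tripleProduct b x y (b z w) =
      b (tripleProduct b x y z) w + b z (tripleProduct b x y w)) (x y z : M) :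
    jacobian (b · ·) x y (b x z) + (2 : 𝕜) • jacobian (b · ·) x z (b x y) =
      b x (jacobian (b · ·) x y z) := by
  have hself (v : M) : b v v = 0 := by
    linear_combination (norm := module) (1 / 2 : 𝕜) • hb v v
  have hxyz := hd x y x z
  simp only [tripleProduct, jacobian, hself, hb y x, hb z x, map_neg, map_add, map_smul,
    LinearMap.smul_apply, LinearMap.add_apply, LinearMap.neg_apply, map_sub,
    LinearMap.sub_apply, map_zero, LinearMap.zero_apply, hb (b x y) x, hb (b x z) x,
    hb (b x z) (b x y), hb y (b x z), hb z (b x y), hb z (b x (b x y)),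
    hb y (b x (b x z))] at hxyz ⊢
  linear_combination (norm := module) (6 : 𝕜) • hxyz

theorem isMaltsevBracket_of_tripleProduct_derivation (hb : ∀ x y, b x y = -b y x)
    (hd : ∀ x y z w, tripleProduct b x y (b z w) =
      b (tripleProduct b x y z) w + b z (tripleProduct b x y w)) :
    IsMaltsevBracket (b · ·) where
  anticomm := hb
  maltsev x y z := by
    have hswap : b x (jacobian (b · ·) x z y) = -b x (jacobian (b · ·) x y z) := by
      simp only [jacobian]
      rw [hb z y, hb y x, hb z x]
      simp only [map_neg, map_add]
      abel
    have hyz := jacobian_add_two_smul_jacobian hb hd x y z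
    have hzy := jacobian_add_two_smul_jacobian hb hd x z y
    rw [hswap] at hzy
    rw [hb]
    linear_combination (norm := module) (1 / 3 : 𝕜) • hyz - (2 / 3 : 𝕜) • hzy

end TripleProduct

section Yamaguti

attribute [local instance] LieRing.ofAssociativeRing

variable {𝕜 M L : Type*} [Field 𝕜] [AddCommGroup M] [Module 𝕜 M] [LieRing L] [LieAlgebra 𝕜 L]

/-- The Yamagutian `Y(x, y) = -[S x, T y] + (1/3) S [x, y] - (1/3) T [x, y]` of a pair of linear
maps, as a bilinear map. -/
def yamaguti (b : M →ₗ[𝕜] M →ₗ[𝕜] M) (S T : M →ₗ[𝕜] L) : M →ₗ[𝕜] M →ₗ[𝕜] L :=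
  -(LieAlgebra.ad 𝕜 L).toLinearMap.compl₁₂ S T + (1 / 3 : 𝕜) • b.compr₂ S
    - (1 / 3 : 𝕜) • b.compr₂ T

theorem yamaguti_apply (b : M →ₗ[𝕜] M →ₗ[𝕜] M) (S T : M →ₗ[𝕜] L) (x y : M) :
    yamaguti b S T x y = -⁅S x, T y⁆ + (1 / 3 : 𝕜) • S (b x y) - (1 / 3 : 𝕜) • T (b x y) :=
  rfl

end Yamaguti

namespace IsTranslationPair

variable {𝕜 M L : Type*} [Field 𝕜] [AddCommGroup M] [Module 𝕜 M] [LieRing L]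
  [LieAlgebra 𝕜 L] {b : M →ₗ[𝕜] M →ₗ[𝕜] M} {S T : M →ₗ[𝕜] L}

theorem symm (h : IsTranslationPair b S T) : IsTranslationPair (-b) T S where
  lie_left x y := by
    rw [h.lie_right, ← h.lie_swap]; simp
  lie_right x y := by
    rw [h.lie_left, ← h.lie_swap]; simp
  lie_swap x y := (h.lie_swap x y).symm

theorem lie_mixed_antisymm (h : IsTranslationPair b S T) (x y : M) :
    ⁅S x, T y⁆ = -⁅S y, T x⁆ := by
  rw [h.lie_swap, ← lie_skew]

theorem left_antisymm (h : IsTranslationPair b S T) (x y : M) : S (b x y) = -S (b y x) := by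
  linear_combination (norm := module) -h.lie_left x y - h.lie_left y x +
    (2 : 𝕜) • h.lie_mixed_antisymm x y - lie_skew (S x) (S y)

theorem right_antisymm (h : IsTranslationPair b S T) (x y : M) : T (b x y) = -T (b y x) := by
  simpa [neg_eq_iff_eq_neg] using h.symm.left_antisymm x y

theorem left_antisymm_left (h : IsTranslationPair b S T) (x y z : M) :
    S (b (b x y) z) = -S (b (b y x) z) := by
  have hxy := h.lie_left (b x y) z
  have hyx := h.lie_left (b y x) z
  rw [h.left_antisymm x y, neg_lie, neg_lie] at hxy
  linear_combination (norm := module) -hxy - hyx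

theorem left_tripleProduct [CharZero 𝕜] (h : IsTranslationPair b S T) (x y z : M) :
    S (tripleProduct b x y z) =
      (1 / 3 : 𝕜) • S (b (b x y) z) - (1 / 6 : 𝕜) • S (cyclicProduct b x y z) := by
  simp only [tripleProduct, cyclicProduct, map_smul, map_add, map_sub]
  rw [h.left_antisymm x, h.left_antisymm y, h.left_antisymm_left z x]
  module

theorem right_tripleProduct [CharZero 𝕜] (h : IsTranslationPair b S T) (x y z : M) :
    T (tripleProduct b x y z) =
      (1 / 3 : 𝕜) • T (b (b x y) z) - (1 / 6 : 𝕜) • T (cyclicProduct b x y z) := by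
  simpa [tripleProduct_neg, cyclicProduct_neg] using h.symm.left_tripleProduct x y z

theorem jacobi_left_left_right (h : IsTranslationPair b S T) (x y z : M) :
    ⁅S (b x y), T z⁆ - (2 : 𝕜) • ⁅⁅S x, T y⁆, T z⁆ =
      -⁅⁅S y, T z⁆, S x⁆ - ⁅⁅S z, T x⁆, S y⁆ := by
  have hjacobi := lie_jacobi (S x) (S y) (T z)
  rw [← lie_skew (S x) ⁅S y, T z⁆, ← lie_skew (T z) ⁅S x, S y⁆, h.lie_left x y,
    ← lie_skew (T z) (S x), h.lie_mixed_antisymm x z, neg_neg,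
    ← lie_skew (S y) ⁅S z, T x⁆, sub_lie, smul_lie] at hjacobi
  linear_combination (norm := module) -hjacobi

theorem jacobi_left_left_left (h : IsTranslationPair b S T) (x y z : M) :
    (2 : 𝕜) • (⁅⁅S x, T y⁆, S z⁆ + ⁅⁅S y, T z⁆, S x⁆ + ⁅⁅S z, T x⁆, S y⁆) =
      S (cyclicProduct b x y z) -
        (2 : 𝕜) • (⁅S (b x y), T z⁆ + ⁅S (b y z), T x⁆ + ⁅S (b z x), T y⁆) := by
  have hjacobi := lie_jacobi (S x) (S y) (S z)
  rw [← lie_skew (S x) ⁅S y, S z⁆, ← lie_skew (S y) ⁅S z, S x⁆, ← lie_skew (S z) ⁅S x, S y⁆,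
    h.lie_left x y, h.lie_left y z, h.lie_left z x] at hjacobi
  simp only [sub_lie, smul_lie, h.lie_left (b _ _)] at hjacobi
  simp only [cyclicProduct, map_add]
  linear_combination (norm := module) hjacobi

theorem lie_lie_left [CharZero 𝕜] (h : IsTranslationPair b S T) (x y z : M) :
    ⁅⁅S x, T y⁆, S z⁆ = -⁅S (b x y), T z⁆ + (1 / 6 : 𝕜) • S (cyclicProduct b x y z) := by
  have hright : -⁅S (b x y), T z⁆ - (2 : 𝕜) • ⁅⁅S x, T y⁆, S z⁆ =
      -⁅⁅S y, T z⁆, T x⁆ - ⁅⁅S z, T x⁆, T y⁆ := by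
    simpa [← h.lie_swap] using h.symm.jacobi_left_left_right x y z
  linear_combination (norm := module)
    (-2 / 3 : 𝕜) • hright - (1 / 3 : 𝕜) • h.jacobi_left_left_right y z x -
      (1 / 3 : 𝕜) • h.jacobi_left_left_right z x y +
      (1 / 6 : 𝕜) • h.jacobi_left_left_left x y z

theorem lie_lie_right [CharZero 𝕜] (h : IsTranslationPair b S T) (x y z : M) :
    ⁅⁅S x, T y⁆, T z⁆ = ⁅S (b x y), T z⁆ + (1 / 6 : 𝕜) • T (cyclicProduct b x y z) := by
  simpa [← h.lie_swap, cyclicProduct_neg] using h.symm.lie_lie_left x y z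

theorem cyclic_lie_mixed [CharZero 𝕜] (h : IsTranslationPair b S T) (x y z : M) :
    ⁅S (b x y), T z⁆ + ⁅S (b y z), T x⁆ + ⁅S (b z x), T y⁆ =
      (1 / 3 : 𝕜) • (S (cyclicProduct b x y z) - T (cyclicProduct b x y z)) := by
  have hjacobi := h.jacobi_left_left_right x y z
  rw [h.lie_lie_right, h.lie_lie_left, h.lie_lie_left, cyclicProduct_rotate b y z x,
    cyclicProduct_rotate b x y z] at hjacobi
  linear_combination (norm := module) -hjacobi

theorem yamaguti_antisymm (h : IsTranslationPair b S T) (x y : M) :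
    yamaguti b S T x y + yamaguti b S T y x = 0 := by
  rw [yamaguti_apply, yamaguti_apply, h.lie_mixed_antisymm x y, h.left_antisymm x y,
    h.right_antisymm x y]
  module

theorem yamaguti_cyclic [CharZero 𝕜] (h : IsTranslationPair b S T) (x y z : M) :
    yamaguti b S T (b x y) z + yamaguti b S T (b y z) x + yamaguti b S T (b z x) y = 0 := by
  have hcyclic := h.cyclic_lie_mixed x y z
  simp only [cyclicProduct, map_add] at hcyclic
  simp only [yamaguti_apply]
  linear_combination (norm := module) -hcyclic

theorem lie_yamaguti_left [CharZero 𝕜] (h : IsTranslationPair b S T) (x y z : M) :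
    ⁅yamaguti b S T x y, S z⁆ = S (tripleProduct b x y z) := by
  rw [h.left_tripleProduct, yamaguti_apply]
  simp only [sub_lie, add_lie, neg_lie, smul_lie, h.lie_lie_left, h.lie_left, ← h.lie_swap]
  module

theorem lie_yamaguti_right [CharZero 𝕜] (h : IsTranslationPair b S T) (x y z : M) :
    ⁅yamaguti b S T x y, T z⁆ = T (tripleProduct b x y z) := by
  rw [h.right_tripleProduct, yamaguti_apply]
  simp only [sub_lie, add_lie, neg_lie, smul_lie, h.lie_lie_right, h.lie_right]
  module

theorem left_tripleProduct_derivation [CharZero 𝕜] (h : IsTranslationPair b S T) (x y z w : M) :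
    S (tripleProduct b x y (b z w)) =
      S (b (tripleProduct b x y z) w + b z (tripleProduct b x y w)) := by
  have hlie := congrArg (⁅yamaguti b S T x y, ·⁆) (h.lie_left z w)
  simp only [lie_sub, lie_smul, leibniz_lie (yamaguti b S T x y) (S _) (S _),
    leibniz_lie (yamaguti b S T x y) (S _) (T _), h.lie_yamaguti_left,
    h.lie_yamaguti_right, h.lie_left (tripleProduct b x y z) w,
    h.lie_left z (tripleProduct b x y w)] at hlie
  rw [map_add]
  linear_combination (norm := module) -hlie

theorem right_tripleProduct_derivation [CharZero 𝕜] (h : IsTranslationPair b S T)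
    (x y z w : M) :
    T (tripleProduct b x y (b z w)) =
      T (b (tripleProduct b x y z) w + b z (tripleProduct b x y w)) := by
  have htriple_neg (v : M) : tripleProduct b x y (-v) = -tripleProduct b x y v := by
    simp only [tripleProduct, map_neg]
    module
  have hsymm := h.symm.left_tripleProduct_derivation x y z w
  rw [tripleProduct_neg] at hsymm
  simp only [LinearMap.neg_apply, map_neg, map_add, htriple_neg] at hsymm ⊢
  linear_combination (norm := module) -hsymm

theorem lie_yamaguti_yamaguti [CharZero 𝕜] (h : IsTranslationPair b S T) (x y z w : M) :
    ⁅yamaguti b S T x y, yamaguti b S T z w⁆ =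
      yamaguti b S T (tripleProduct b x y z) w + yamaguti b S T z (tripleProduct b x y w) := by
  rw [yamaguti_apply b S T z w]
  simp only [lie_sub, lie_add, lie_neg, lie_smul,
    leibniz_lie (yamaguti b S T x y) (S _) (T _), h.lie_yamaguti_left,
    h.lie_yamaguti_right, h.left_tripleProduct_derivation x y z w,
    h.right_tripleProduct_derivation x y z w]
  simp only [yamaguti_apply, map_add]
  module

theorem isMaltsevBracket [CharZero 𝕜] (h : IsTranslationPair b S T)
    (hS : Function.Injective S) : IsMaltsevBracket (b · ·) :=
  isMaltsevBracket_of_tripleProduct_derivation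
    (fun x y => hS <| by rw [map_neg, h.left_antisymm])
    (fun x y z w => hS <| h.left_tripleProduct_derivation x y z w)

theorem comp {M' : Type*} [AddCommGroup M'] [Module 𝕜 M'] {b' : M' →ₗ[𝕜] M' →ₗ[𝕜] M'}
    (h : IsTranslationPair b S T) (f : M' →ₗ[𝕜] M) (hf : ∀ x y, f (b' x y) = b (f x) (f y)) :
    IsTranslationPair b' (S ∘ₗ f) (T ∘ₗ f) where
  lie_left x y := by simp [hf, h.lie_left]
  lie_right x y := by simp [hf, h.lie_right]
  lie_swap x y := h.lie_swap (f x) (f y)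

end IsTranslationPair

/-! ### Structure constants -/

section StructureConstants

attribute [local instance] LieRing.ofAssociativeRing

variable {r : ℕ}

/-- The product `bracketOf c` as a bilinear map. -/
def bracketLinear (c : Fin r → Fin r → Fin r → ℝ) :
    (Fin r → ℝ) →ₗ[ℝ] (Fin r → ℝ) →ₗ[ℝ] (Fin r → ℝ) :=
  LinearMap.mk₂ ℝ (bracketOf c)
    (fun x x' y => funext fun i => by
      simp only [bracketOf, Pi.add_apply, mul_add, add_mul, Finset.sum_add_distrib])
    (fun a x y => funext fun i => by
      simp only [bracketOf, Pi.smul_apply, smul_eq_mul, Finset.mul_sum, mul_left_comm, mul_assoc])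
    (fun x y y' => funext fun i => by
      simp only [bracketOf, Pi.add_apply, mul_add, Finset.sum_add_distrib])
    (fun a x y => funext fun i => by
      simp only [bracketOf, Pi.smul_apply, smul_eq_mul, Finset.mul_sum, mul_left_comm, mul_assoc])

theorem bracketLinear_apply (c : Fin r → Fin r → Fin r → ℝ) (x y : Fin r → ℝ) :
    bracketLinear c x y = bracketOf c x y :=
  rfl

theorem bracketLinear_single_single (c : Fin r → Fin r → Fin r → ℝ) (j k : Fin r) :
    bracketLinear c (Pi.single j 1) (Pi.single k 1) = fun i => c i j k := by
  funext i
  simp [bracketLinear_apply, bracketOf, Pi.single_apply]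

theorem tripleProduct_bracketLinear_single (c : Fin r → Fin r → Fin r → ℝ) (j k l : Fin r) :
    tripleProduct (bracketLinear c) (Pi.single j 1) (Pi.single k 1) (Pi.single l 1) =
      fun p => yamagutiConstant c p j k l := by
  funext p
  simp only [tripleProduct, bracketLinear_apply, bracketOf,
    yamagutiConstant, Pi.smul_apply, Pi.add_apply, Pi.sub_apply, Pi.single_apply, mul_ite, ite_mul,
    mul_one, mul_zero, zero_mul, Finset.sum_ite_eq', Finset.mem_univ, if_true,
    Finset.sum_add_distrib, Finset.sum_sub_distrib, smul_eq_mul, Finset.sum_const_zero,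
    Finset.sum_ite_irrel]
  ring

variable {A : Type*} [Ring A] [Algebra ℂ A]

theorem linearCombination_eq_complex_sum (σ : Fin r → A) (x : Fin r → ℝ) :
    Fintype.linearCombination ℝ σ x = ∑ p, (x p : ℂ) • σ p := by
  simp only [Fintype.linearCombination_apply, Complex.coe_smul]

theorem yamaguti_linearCombination_single (c : Fin r → Fin r → Fin r → ℝ) (σ τ : Fin r → A)
    (j k : Fin r) :
    yamaguti (bracketLinear c) (Fintype.linearCombination ℝ σ) (Fintype.linearCombination ℝ τ)
      (Pi.single j 1) (Pi.single k 1) = yamagutian c σ τ j k := by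
  have hthird (a : A) : (1 / 3 : ℝ) • a = (1 / 3 : ℂ) • a := by
    rw [← Complex.coe_smul]
    norm_num
  rw [yamaguti_apply, yamagutian, bracketLinear_single_single, hthird, hthird,
    Fintype.linearCombination_apply_single, Fintype.linearCombination_apply_single, one_smul,
    one_smul, linearCombination_eq_complex_sum, linearCombination_eq_complex_sum]

theorem yamaguti_linearCombination_left (c : Fin r → Fin r → Fin r → ℝ) (σ τ : Fin r → A)
    (v : Fin r → ℝ) (k : Fin r) :
    yamaguti (bracketLinear c) (Fintype.linearCombination ℝ σ) (Fintype.linearCombination ℝ τ)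
      v (Pi.single k 1) = ∑ p, (v p : ℂ) • yamagutian c σ τ p k := by
  conv_lhs => rw [pi_eq_sum_univ' v]
  simp only [map_sum, map_smul, LinearMap.sum_apply, LinearMap.smul_apply,
    yamaguti_linearCombination_single, Complex.coe_smul]

theorem yamaguti_linearCombination_right (c : Fin r → Fin r → Fin r → ℝ) (σ τ : Fin r → A)
    (v : Fin r → ℝ) (k : Fin r) :
    yamaguti (bracketLinear c) (Fintype.linearCombination ℝ σ) (Fintype.linearCombination ℝ τ)
      (Pi.single k 1) v = ∑ p, (v p : ℂ) • yamagutian c σ τ k p := by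
  conv_lhs => rw [pi_eq_sum_univ' v]
  simp only [map_sum, map_smul, yamaguti_linearCombination_single, Complex.coe_smul]

namespace IsTranslationPair

variable {c : Fin r → Fin r → Fin r → ℝ} {σ τ : Fin r → A}

theorem lie_left_single (h : IsTranslationPair (bracketLinear c) (Fintype.linearCombination ℝ σ)
    (Fintype.linearCombination ℝ τ)) (j k : Fin r) :
    ⁅σ j, σ k⁆ = ∑ p, (c p j k : ℂ) • σ p - (2 : ℂ) • ⁅σ j, τ k⁆ := by
  simpa only [bracketLinear_single_single, linearCombination_eq_complex_sum,
    Fintype.linearCombination_apply_single, one_smul, two_smul] using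
    h.lie_left (Pi.single j 1) (Pi.single k 1)

theorem lie_right_single (h : IsTranslationPair (bracketLinear c) (Fintype.linearCombination ℝ σ)
    (Fintype.linearCombination ℝ τ)) (j k : Fin r) :
    ⁅τ j, τ k⁆ = -∑ p, (c p j k : ℂ) • τ p - (2 : ℂ) • ⁅σ j, τ k⁆ := by
  simpa only [bracketLinear_single_single, linearCombination_eq_complex_sum,
    Fintype.linearCombination_apply_single, one_smul, two_smul] using
    h.lie_right (Pi.single j 1) (Pi.single k 1)

theorem isMaltsevBirepresentation (hc : IsMaltsevBracket (bracketOf c))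
    (h : IsTranslationPair (bracketLinear c) (Fintype.linearCombination ℝ σ)
      (Fintype.linearCombination ℝ τ)) :
    IsMaltsevBirepresentation c σ τ (yamagutian c σ τ) where
  isMaltsev := hc
  comm_left_left j k := by rw [h.lie_left_single, yamagutian]; module
  comm_left_right j k := by rw [yamagutian]; module
  comm_right_right j k := by rw [h.lie_right_single, yamagutian]; module
  yamaguti_antisymm j k := by
    simpa only [yamaguti_linearCombination_single] using
      h.yamaguti_antisymm (Pi.single j 1) (Pi.single k 1)
  yamaguti_cyclic j k l := by
    simpa only [bracketLinear_single_single, yamaguti_linearCombination_left,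
      Finset.sum_add_distrib] using
      h.yamaguti_cyclic (Pi.single j 1) (Pi.single k 1) (Pi.single l 1)
  reductivity_left j k l := by
    simpa only [yamaguti_linearCombination_single, tripleProduct_bracketLinear_single,
      Fintype.linearCombination_apply_single, one_smul, linearCombination_eq_complex_sum] using
      h.lie_yamaguti_left (Pi.single j 1) (Pi.single k 1) (Pi.single l 1)
  reductivity_right j k l := by
    simpa only [yamaguti_linearCombination_single, tripleProduct_bracketLinear_single,
      Fintype.linearCombination_apply_single, one_smul, linearCombination_eq_complex_sum] using
      h.lie_yamaguti_right (Pi.single j 1) (Pi.single k 1) (Pi.single l 1)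
  comm_yamaguti j k l q := by
    have hlie := h.lie_yamaguti_yamaguti (Pi.single j 1) (Pi.single k 1) (Pi.single l 1)
      (Pi.single q 1)
    rwa [yamaguti_linearCombination_single, yamaguti_linearCombination_single,
      tripleProduct_bracketLinear_single, tripleProduct_bracketLinear_single,
      yamaguti_linearCombination_left, yamaguti_linearCombination_right,
      ← Finset.sum_add_distrib] at hlie

end IsTranslationPair

end StructureConstants

/-! ### Commutators of charges -/

section Charges

attribute [local instance] LieRing.ofAssociativeRing

theorem lie_mul_eq_add {A : Type*} [Ring A] (a b c : A) : ⁅a, b * c⁆ = ⁅a, b⁆ * c + b * ⁅a, c⁆ := by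
  simp only [Ring.lie_def]
  noncomm_ring

theorem FieldStatistics.lie_mul_eq_bracket {A : Type*} [Ring A] (stat : FieldStatistics)
    (a b c : A) : ⁅a * b, c⁆ = a * stat.bracket b c - stat.bracket c a * b := by
  cases stat <;> simp only [FieldStatistics.bracket, Ring.lie_def] <;> noncomm_ring

theorem lie_sum_smul_mul {R A ι : Type*} [CommRing R] [Ring A] [Algebra R A] [Fintype ι]
    {M N : Matrix ι ι R} {a b : ι → A} {c : A} (ha : ∀ j, ⁅c, a j⁆ = ∑ i, M i j • a i)
    (hb : ∀ i, ⁅c, b i⁆ = -∑ j, M i j • b j) :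
    ⁅c, ∑ i, ∑ j, N i j • (a i * b j)⁆ = ∑ i, ∑ j, (M * N - N * M) i j • (a i * b j) := by
  have hlie (i j : ι) : ⁅c, N i j • (a i * b j)⁆ =
      N i j • ((∑ k, M k i • a k) * b j) - N i j • (a i * ∑ k, M j k • b k) := by
    rw [Ring.lie_def, mul_smul_comm, smul_mul_assoc, ← smul_sub, ← Ring.lie_def, lie_mul_eq_add,
      ha, hb, mul_neg, ← sub_eq_add_neg, smul_sub]
  simp only [lie_sum, hlie, Finset.sum_sub_distrib, Matrix.sub_apply, sub_smul]
  congr 1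
  · calc ∑ i, ∑ j, N i j • ((∑ k, M k i • a k) * b j)
        = ∑ i, ∑ j, ∑ k, (M k i * N i j) • (a k * b j) := by
          simp only [Finset.sum_mul, Finset.smul_sum, smul_mul_assoc, smul_smul, mul_comm]
      _ = ∑ i, ∑ k, ∑ j, (M k i * N i j) • (a k * b j) :=
          Finset.sum_congr rfl fun i _ => Finset.sum_comm
      _ = ∑ k, ∑ i, ∑ j, (M k i * N i j) • (a k * b j) := Finset.sum_comm
      _ = ∑ k, ∑ j, (M * N) k j • (a k * b j) := by
          refine Finset.sum_congr rfl fun k _ => ?_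
          rw [Finset.sum_comm]
          simp only [Matrix.mul_apply, Finset.sum_smul]
  · refine Finset.sum_congr rfl fun i _ => ?_
    simp only [Finset.mul_sum, Finset.smul_sum, mul_smul_comm, smul_smul, Matrix.mul_apply,
      Finset.sum_smul]
    exact Finset.sum_comm

variable {D : Type*} [NormedAddCommGroup D] [InnerProductSpace ℂ D]

variable (D) in
/-- The algebra of operators on `D`: the linear maps `D → D` having an adjoint on `D`. -/
def adjointableSubalgebra : Subalgebra ℂ (Module.End ℂ D) where
  carrier := {A | HasAdjointOn A}
  mul_mem' := by
    rintro A B ⟨A', hA⟩ ⟨B', hB⟩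
    exact ⟨B' * A', fun x y => by simp only [Module.End.mul_apply, hA, hB]⟩
  add_mem' := by
    rintro A B ⟨A', hA⟩ ⟨B', hB⟩
    exact ⟨A' + B', fun x y => by
      simp only [LinearMap.add_apply, inner_add_left, inner_add_right, hA, hB]⟩
  algebraMap_mem' c := ⟨algebraMap ℂ _ (starRingEnd ℂ c), fun x y => by
    simp only [Module.algebraMap_end_apply, inner_smul_left, inner_smul_right, Complex.conj_conj]⟩

theorem HasAdjointOn.mem {A : Module.End ℂ D} (hA : HasAdjointOn A) :
    A ∈ adjointableSubalgebra D :=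
  hA

variable {n m : ℕ} {stat : FieldStatistics} {K : ℕ → SplittingKernel m}
  {p u : Fin n → OperatorField m D} {M N : Matrix (Fin n) (Fin n) ℂ} {Q Q' : Module.End ℂ D}

theorem splitCharge_add (κ : SplittingKernel m) :
    splitCharge κ p (M + N) u = splitCharge κ p M u + splitCharge κ p N u := by
  simp only [splitCharge, Matrix.add_apply, add_smul, Finset.sum_add_distrib, smul_add]

theorem splitCharge_smul (κ : SplittingKernel m) (c : ℂ) :
    splitCharge κ p (c • M) u = c • splitCharge κ p M u := by
  simp only [splitCharge, Matrix.smul_apply, smul_eq_mul, mul_smul, ← Finset.smul_sum,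
    smul_comm (-Complex.I) c]

theorem lie_splitCharge_eq_bracket (κ : SplittingKernel m) (V : Module.End ℂ D) :
    ⁅splitCharge κ p M u, V⁆ =
      (-Complex.I) • ∑ k, ∑ A, ∑ B, M A B •
        ((p A).smear (κ.left k) * stat.bracket ((u B).smear (κ.right k)) V -
          stat.bracket V ((p A).smear (κ.left k)) * (u B).smear (κ.right k)) := by
  simp only [splitCharge, smul_lie, sum_lie, stat.lie_mul_eq_bracket]

theorem CanonicalETC.lie_splitCharge_field (h : CanonicalETC stat u p) (κ : SplittingKernel m)
    (C : Fin n) (f : 𝓢(Space m, ℂ)) :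
    ⁅splitCharge κ p M u, (u C).smear f⁆ =
      -∑ B, M C B • (u B).smear (∑ k, (∫ x, κ.left k x * f x) • κ.right k) := by
  rw [lie_splitCharge_eq_bracket (stat := stat)]
  simp only [h.field_field, h.field_momentum, mul_zero, zero_sub, smul_neg,
    Finset.sum_neg_distrib, map_sum, map_smul, ite_smul, zero_smul, ite_mul, zero_mul, smul_ite,
    smul_zero, smul_mul_assoc, one_mul, Finset.sum_ite_irrel, Finset.sum_const_zero,
    Finset.sum_ite_eq, Finset.mem_univ, if_true, Finset.smul_sum, neg_smul, neg_neg]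
  rw [Finset.sum_comm]
  simp only [← Finset.sum_neg_distrib]
  refine Finset.sum_congr rfl fun B _ => Finset.sum_congr rfl fun k _ => ?_
  simp only [smul_smul, ← neg_smul, mul_comm (f _)]
  congr 1
  linear_combination (M C B * ∫ x, κ.left k x * f x) * Complex.I_mul_I

theorem CanonicalETC.lie_splitCharge_momentum (h : CanonicalETC stat u p)
    (κ : SplittingKernel m) (C : Fin n) (f : 𝓢(Space m, ℂ)) :
    ⁅splitCharge κ p M u, (p C).smear f⁆ =
      ∑ A, M A C • (p A).smear (∑ k, (∫ x, κ.right k x * f x) • κ.left k) := by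
  rw [lie_splitCharge_eq_bracket (stat := stat)]
  simp only [h.momentum_momentum, h.field_momentum, zero_mul, sub_zero, map_sum, map_smul,
    ite_smul, zero_smul, mul_ite, mul_zero, smul_ite, smul_zero, mul_smul_comm, mul_one,
    Finset.sum_ite_eq', Finset.mem_univ, if_true, Finset.smul_sum]
  rw [Finset.sum_comm]
  refine Finset.sum_congr rfl fun A _ => Finset.sum_congr rfl fun k _ => ?_
  simp only [smul_smul]
  congr 1
  linear_combination (-M A C * ∫ x, κ.right k x * f x) * Complex.I_mul_I

theorem OperatorField.tendsto_sum_smear {F : Fin n → OperatorField m D} {ι : Type*}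
    {l : Filter ι} {f : ι → 𝓢(Space m, ℂ)} {g : 𝓢(Space m, ℂ)} (hf : Filter.Tendsto f l (nhds g))
    (a : Fin n → ℂ) (x y : D) :
    Filter.Tendsto (fun ν => ⟪x, (∑ B, a B • (F B).smear (f ν)) y⟫_ℂ) l
      (nhds ⟪x, (∑ B, a B • (F B).smear g) y⟫_ℂ) := by
  simp only [LinearMap.sum_apply, LinearMap.smul_apply, inner_sum, inner_smul_right]
  exact tendsto_finsetSum _ fun B _ =>
    ((((F B).continuous_matrixElement x y).tendsto g).comp hf).const_mul _

namespace IsNoetherCharge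

theorem unique (h : IsNoetherCharge K p M u Q) (h' : IsNoetherCharge K p M u Q') : Q = Q' :=
  LinearMap.ext fun y => ext_inner_left ℂ fun x => tendsto_nhds_unique (h.2 x y) (h'.2 x y)

variable (K p u) in
/-- The graph of the linear relation assigning to a matrix `M` the charge `-i ∫ p M u`. -/
def graph : Submodule ℂ (Matrix (Fin n) (Fin n) ℂ × Module.End ℂ D) where
  carrier := {q | IsNoetherCharge K p q.1 u q.2}
  zero_mem' := ⟨zero_mem (adjointableSubalgebra D), fun x y => by simp [splitCharge]⟩
  add_mem' h h' := ⟨add_mem h.1.mem h'.1.mem, fun x y => by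
    simpa only [Prod.fst_add, Prod.snd_add, splitCharge_add, LinearMap.add_apply,
      inner_add_right] using (h.2 x y).add (h'.2 x y)⟩
  smul_mem' c _ h := ⟨Subalgebra.smul_mem _ h.1.mem c, fun x y => by
    simpa only [Prod.smul_fst, Prod.smul_snd, splitCharge_smul, LinearMap.smul_apply,
      inner_smul_right] using (h.2 x y).const_mul c⟩

theorem mem_graph : (M, Q) ∈ graph K p u ↔ IsNoetherCharge K p M u Q :=
  Iff.rfl

theorem real_smul (h : IsNoetherCharge K p M u Q) (c : ℝ) :
    IsNoetherCharge K p (c • M) u (c • Q) := by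
  have hcomplex : IsNoetherCharge K p ((c : ℂ) • M) u ((c : ℂ) • Q) :=
    (graph K p u).smul_mem _ (mem_graph.2 h)
  simpa only [Complex.coe_smul] using hcomplex

theorem sub (h : IsNoetherCharge K p M u Q) (h' : IsNoetherCharge K p N u Q') :
    IsNoetherCharge K p (M - N) u (Q - Q') :=
  (graph K p u).sub_mem (mem_graph.2 h) (mem_graph.2 h')

theorem linearCombination {ι : Type*} [Fintype ι] {s : ι → Matrix (Fin n) (Fin n) ℂ}
    {σ : ι → Module.End ℂ D} (h : ∀ j, IsNoetherCharge K p (s j) u (σ j)) (x : ι → ℝ) :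
    IsNoetherCharge K p (Fintype.linearCombination ℝ s x) u
      (Fintype.linearCombination ℝ σ x) := by
  rw [← mem_graph]
  simpa only [Fintype.linearCombination_apply, prod_mk_sum] using
    (graph K p u).sum_mem fun j _ => (h j).real_smul (x j)

theorem tendsto_lie (h : IsNoetherCharge K p M u Q) {V : Module.End ℂ D}
    (hV : HasAdjointOn V) (x y : D) :
    Filter.Tendsto (fun ν => ⟪x, ⁅splitCharge (K ν) p M u, V⁆ y⟫_ℂ) Filter.atTop
      (nhds ⟪x, ⁅Q, V⁆ y⟫_ℂ) := by
  obtain ⟨V', hV⟩ := hV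
  simpa only [Ring.lie_def, LinearMap.sub_apply, Module.End.mul_apply, inner_sub_right, ← hV]
    using (h.2 x (V y)).sub (h.2 (V' x) y)

theorem lie_field (h : IsNoetherCharge K p M u Q) (hETC : CanonicalETC stat u p)
    (hK : IsDeltaSequence K) (C : Fin n) (f : 𝓢(Space m, ℂ)) :
    ⁅Q, (u C).smear f⁆ = -∑ B, M C B • (u B).smear f := by
  refine LinearMap.ext fun y => ext_inner_left ℂ fun x =>
    tendsto_nhds_unique (h.tendsto_lie ((u C).hasAdjoint f) x y) ?_
  simpa only [hETC.lie_splitCharge_field, LinearMap.neg_apply, inner_neg_right] using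
    (OperatorField.tendsto_sum_smear (F := u) (hK f).2 (M C) x y).neg

theorem lie_momentum (h : IsNoetherCharge K p M u Q) (hETC : CanonicalETC stat u p)
    (hK : IsDeltaSequence K) (C : Fin n) (f : 𝓢(Space m, ℂ)) :
    ⁅Q, (p C).smear f⁆ = ∑ A, M A C • (p A).smear f := by
  refine LinearMap.ext fun y => ext_inner_left ℂ fun x =>
    tendsto_nhds_unique (h.tendsto_lie ((p C).hasAdjoint f) x y) ?_
  simpa only [hETC.lie_splitCharge_momentum] using
    OperatorField.tendsto_sum_smear (F := p) (hK f).1 (fun A => M A C) x y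

theorem lie_splitCharge (h : IsNoetherCharge K p M u Q) (hETC : CanonicalETC stat u p)
    (hK : IsDeltaSequence K) (κ : SplittingKernel m) :
    ⁅Q, splitCharge κ p N u⁆ = splitCharge κ p ⁅M, N⁆ u := by
  rw [splitCharge, splitCharge, lie_smul, lie_sum]
  refine congrArg _ (Finset.sum_congr rfl fun k _ => ?_)
  exact lie_sum_smul_mul (fun C => h.lie_momentum hETC hK C _) (fun C => h.lie_field hETC hK C _)

theorem lie (h : IsNoetherCharge K p M u Q) (h' : IsNoetherCharge K p N u Q')
    (hETC : CanonicalETC stat u p) (hK : IsDeltaSequence K) :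
    IsNoetherCharge K p ⁅M, N⁆ u ⁅Q, Q'⁆ := by
  refine ⟨sub_mem (mul_mem h.1.mem h'.1.mem) (mul_mem h'.1.mem h.1.mem), fun x y => ?_⟩
  have hlim := (h'.tendsto_lie h.1 x y).neg
  simpa only [← inner_neg_right, ← LinearMap.neg_apply, lie_skew,
    h.lie_splitCharge hETC hK] using hlim

end IsNoetherCharge

theorem IsTranslationPair.of_charges {ι : Type*} [Fintype ι]
    {b : (ι → ℝ) →ₗ[ℝ] (ι → ℝ) →ₗ[ℝ] (ι → ℝ)}
    {s t : ι → Matrix (Fin n) (Fin n) ℂ} {σ τ : ι → Module.End ℂ D}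
    (hst : IsTranslationPair b (Fintype.linearCombination ℝ s) (Fintype.linearCombination ℝ t))
    (hETC : CanonicalETC stat u p) (hK : IsDeltaSequence K)
    (hσ : ∀ j, IsNoetherCharge K p (s j) u (σ j)) (hτ : ∀ j, IsNoetherCharge K p (t j) u (τ j)) :
    IsTranslationPair b (Fintype.linearCombination ℝ σ) (Fintype.linearCombination ℝ τ) := by
  have hs := IsNoetherCharge.linearCombination hσ
  have ht := IsNoetherCharge.linearCombination hτ
  have hmixed (x y) := (hs x).lie (ht y) hETC hK
  refine ⟨fun x y => ?_, fun x y => ?_, fun x y => ?_⟩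
  · have hleft := (hs x).lie (hs y) hETC hK
    rw [hst.lie_left] at hleft
    exact hleft.unique ((hs _).sub ((hmixed x y).real_smul 2))
  · have hright := (ht x).lie (ht y) hETC hK
    rw [hst.lie_right, ← map_neg] at hright
    rw [← map_neg]
    exact hright.unique ((ht _).sub ((hmixed x y).real_smul 2))
  · have hswap := hmixed x y
    rw [hst.lie_swap] at hswap
    exact hswap.unique ((ht x).lie (hs y) hETC hK)

end Charges

/-! ### Identities in Moufang loops -/

namespace MoufangLoop

variable {G : Type*} [MoufangLoop G]

theorem mul_left_cancel' {a g h : G} (e : a * g = a * h) : g = h := (mul_left_bijective' a).1 e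

theorem mul_right_cancel' {a g h : G} (e : g * a = h * a) : g = h := (mul_right_bijective' a).1 e

theorem flexible (a g : G) : a * (g * a) = (a * g) * a := by
  have := moufang' a 1 g
  rwa [mul_one', one_mul'] at this

theorem mul_inv_cancel_left' (a g : G) : a * (a⁻¹ * g) = g := by
  have := moufang' a a⁻¹ g
  rw [mul_inv', one_mul'] at this
  exact (mul_right_cancel' this).symm

theorem inv_mul_cancel_right' (a g : G) : (g * a⁻¹) * a = g := by
  have := moufang' a g a⁻¹
  rw [inv_mul', mul_one', ← flexible] at this
  exact (mul_left_cancel' this).symm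

theorem inv_inv' (a : G) : a⁻¹⁻¹ = a := by
  apply mul_left_cancel' (a := a⁻¹)
  rw [mul_inv', inv_mul']

theorem inv_mul_cancel_left' (a g : G) : a⁻¹ * (a * g) = g := by
  simpa only [inv_inv'] using mul_inv_cancel_left' a⁻¹ g

theorem mul_inv_cancel_right' (a g : G) : (g * a) * a⁻¹ = g := by
  simpa only [inv_inv'] using inv_mul_cancel_right' a⁻¹ g

theorem mul_inv_rev' (g h : G) : (g * h)⁻¹ = h⁻¹ * g⁻¹ := by
  have h1 : g⁻¹ = h * (g * h)⁻¹ := by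
    apply mul_right_cancel' (a := g * h)
    rw [inv_mul_cancel_right', inv_mul_cancel_left']
  rw [h1, inv_mul_cancel_left']

theorem mul_mul_mul_left (g h x : G) : (g * (h * x)) * g = (g * h) * (x * g) :=
  (moufang' g h x).symm

theorem right_moufang (h g x : G) : ((h * g) * x) * g = h * (g * (x * g)) := by
  have key : ∀ a w : G, (a * g⁻¹) * ((g * w) * g) = (a * w) * g := fun a w => by
    have := mul_mul_mul_left g a⁻¹ (a * w)
    rw [inv_mul_cancel_left'] at this
    have e : a * g⁻¹ = (g * a⁻¹)⁻¹ := by rw [mul_inv_rev', inv_inv']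
    rw [this, e, inv_mul_cancel_left']
  have := key (h * g) x
  rw [mul_inv_cancel_right'] at this
  rw [flexible, this]

theorem left_moufang (h g x : G) : g * (x * (g * h)) = ((g * x) * g) * h := by
  have := congrArg (·⁻¹) (right_moufang h⁻¹ g⁻¹ x⁻¹)
  simpa only [mul_inv_rev', inv_inv'] using this
end MoufangLoop

namespace IsBirepresentation

variable {n : ℕ} {G : Type*} [MoufangLoop G] {S T : G → GL (Fin n) ℂ}

theorem left_inv (h : IsBirepresentation S T) (g : G) : S g⁻¹ = (S g)⁻¹ := by
  have hg := h.left_mul g g⁻¹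
  rw [MoufangLoop.mul_inv', h.left_one, one_mul, mul_assoc] at hg
  exact eq_inv_of_mul_eq_one_right (mul_eq_left.mp hg)

theorem right_inv (h : IsBirepresentation S T) (g : G) : T g⁻¹ = (T g)⁻¹ := by
  have hg := h.right_mul g g⁻¹
  rw [MoufangLoop.inv_mul', h.right_one, one_mul, mul_assoc] at hg
  exact eq_inv_of_mul_eq_one_right (mul_eq_left.mp hg)

theorem comm (h : IsBirepresentation S T) (g : G) : T g * S g = S g * T g := by
  simpa only [h.left_one, mul_one, MoufangLoop.mul_one'] using h.left_mul g 1

theorem right_mul_left (h : IsBirepresentation S T) (g k : G) :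
    T g * S (k * g) = S k * (T g * S g) := by
  have hinv := congrArg (·⁻¹) (h.left_mul g⁻¹ k⁻¹)
  simp only [← MoufangLoop.mul_inv_rev', h.left_inv, h.right_inv, mul_inv_rev, inv_inv] at hinv
  rw [← hinv, h.comm]

theorem left_mul_right (h : IsBirepresentation S T) (g k : G) :
    S g * T (g * k) = T k * (S g * T g) := by
  have hinv := congrArg (·⁻¹) (h.right_mul g⁻¹ k⁻¹)
  simp only [← MoufangLoop.mul_inv_rev', h.left_inv, h.right_inv, mul_inv_rev, inv_inv] at hinv
  rw [← hinv, h.comm]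

end IsBirepresentation

/-! ### Local Moufang loops -/

section LocalLoop

open Filter Topology TopologicalSpace VectorField

section SecondDerivative

variable {E F : Type*} [NormedAddCommGroup E] [NormedSpace ℝ E] [NormedAddCommGroup F]
  [NormedSpace ℝ F] {f : E → F} {x : E}

theorem hasFDerivAt_fderiv_of_contDiffAt (hf : ContDiffAt ℝ ∞ f x) :
    HasFDerivAt (fderiv ℝ f) (fderiv ℝ (fderiv ℝ f) x) x :=
  ((hf.fderiv_right (m := 1) (by norm_cast)).differentiableAt one_ne_zero).hasFDerivAt

theorem fderiv_fderiv_comm_of_contDiffAt (hf : ContDiffAt ℝ ∞ f x) (v w : E) :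
    fderiv ℝ (fderiv ℝ f) x v w = fderiv ℝ (fderiv ℝ f) x w v :=
  ((contDiffAt_infty.1 hf 2).isSymmSndFDerivAt (by simp)).eq v w

end SecondDerivative

variable {V : Type*} [NormedAddCommGroup V] [NormedSpace ℝ V]

/-- A smooth local Moufang loop on the open set `U` of a normed space, with unit `e`. The Moufang
identities are required near `e` in two of the variables. -/
structure IsLocalMoufangLoop (m : V × V → V) (U : Opens V) (e : V) : Prop where
  mem : e ∈ U
  contDiffAt_left : ∀ p ∈ U, ContDiffAt ℝ ∞ m (e, p)
  contDiffAt_right : ∀ p ∈ U, ContDiffAt ℝ ∞ m (p, e)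
  one_mul : ∀ p ∈ U, m (e, p) = p
  mul_one : ∀ p ∈ U, m (p, e) = p
  middle : ∀ p ∈ U, ∀ᶠ z : V × V in 𝓝 (e, e),
    m (m (z.2, m (z.1, p)), z.2) = m (m (z.2, z.1), m (p, z.2))
  middle' : ∀ p ∈ U, ∀ᶠ z : V × V in 𝓝 (e, e),
    m (z.2, m (m (p, z.1), z.2)) = m (m (z.2, p), m (z.1, z.2))
  right : ∀ p ∈ U, ∀ᶠ z : V × V in 𝓝 (e, e),
    m (m (m (z.1, z.2), p), z.2) = m (z.1, m (z.2, m (p, z.2)))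
  left : ∀ p ∈ U, ∀ᶠ z : V × V in 𝓝 (e, e),
    m (z.2, m (p, m (z.2, z.1))) = m (m (m (z.2, p), z.2), z.1)

/-- The infinitesimal left translation `x ↦ ∂(h p)/∂h` at `h = e` in direction `x`. For fixed `x`
it is a vector field in `p`. -/
def leftTranslation (m : V × V → V) (e p : V) : V →L[ℝ] V :=
  (fderiv ℝ m (e, p)).comp (ContinuousLinearMap.inl ℝ V V)

/-- The infinitesimal right translation `x ↦ ∂(p h)/∂h` at `h = e` in direction `x`. For fixed `x`
it is a vector field in `p`. -/
def rightTranslation (m : V × V → V) (e p : V) : V →L[ℝ] V :=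
  (fderiv ℝ m (p, e)).comp (ContinuousLinearMap.inr ℝ V V)

/-- The mixed second derivative `(x, y) ↦ ∂²(g h)/∂g∂h` at the unit, in direction `x` in `g` and
`y` in `h`. -/
def mixedDerivative (m : V × V → V) (e : V) : V →L[ℝ] V →L[ℝ] V :=
  ((fderiv ℝ (fderiv ℝ m) (e, e)).bilinearComp (ContinuousLinearMap.inr ℝ V V)
    (ContinuousLinearMap.inl ℝ V V)).flip

/-- The tangent product `[x, y]`, the antisymmetrized mixed second derivative of the
multiplication at the unit. -/
def tangentProduct (m : V × V → V) (e : V) : V →ₗ[ℝ] V →ₗ[ℝ] V :=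
  (mixedDerivative m e - (mixedDerivative m e).flip).toLinearMap₁₂

theorem leftTranslation_apply (m : V × V → V) (e p x : V) :
    leftTranslation m e p x = fderiv ℝ m (e, p) (x, 0) := rfl

theorem mixedDerivative_apply (m : V × V → V) (e x y : V) :
    mixedDerivative m e x y = fderiv ℝ (fderiv ℝ m) (e, e) (0, y) (x, 0) := rfl

theorem tangentProduct_apply (m : V × V → V) (e x y : V) :
    tangentProduct m e x y = mixedDerivative m e x y - mixedDerivative m e y x := rfl

theorem leftTranslation_comp_swap (m : V × V → V) (e : V) :
    leftTranslation (m ∘ Prod.swap) e = rightTranslation m e := by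
  ext p x
  exact congrArg (· (x, 0))
    ((ContinuousLinearEquiv.prodComm ℝ V V).comp_right_fderiv (f := m) (x := (e, p)))

theorem rightTranslation_comp_swap (m : V × V → V) (e : V) :
    rightTranslation (m ∘ Prod.swap) e = leftTranslation m e := by
  ext p x
  exact congrArg (· (0, x))
    ((ContinuousLinearEquiv.prodComm ℝ V V).comp_right_fderiv (f := m) (x := (p, e)))

namespace IsLocalMoufangLoop

variable {m : V × V → V} {U : Opens V} {e p : V}

theorem swap (h : IsLocalMoufangLoop m U e) : IsLocalMoufangLoop (m ∘ Prod.swap) U e where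
  mem := h.mem
  contDiffAt_left p hp := (h.contDiffAt_right p hp).comp (e, p)
    (ContinuousLinearEquiv.prodComm ℝ V V).contDiff.contDiffAt
  contDiffAt_right p hp := (h.contDiffAt_left p hp).comp (p, e)
    (ContinuousLinearEquiv.prodComm ℝ V V).contDiff.contDiffAt
  one_mul := h.mul_one
  mul_one := h.one_mul
  middle := h.middle'
  middle' := h.middle
  right := h.left
  left := h.right

theorem hasFDerivAt_left (h : IsLocalMoufangLoop m U e) (hp : p ∈ U) :
    HasFDerivAt m (fderiv ℝ m (e, p)) (e, p) :=
  ((h.contDiffAt_left p hp).differentiableAt (by simp)).hasFDerivAt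

theorem hasFDerivAt_right (h : IsLocalMoufangLoop m U e) (hp : p ∈ U) :
    HasFDerivAt m (fderiv ℝ m (p, e)) (p, e) :=
  ((h.contDiffAt_right p hp).differentiableAt (by simp)).hasFDerivAt

theorem hasFDerivAt_mul_left (h : IsLocalMoufangLoop m U e) (hp : p ∈ U) :
    HasFDerivAt (fun g => m (g, p)) (leftTranslation m e p) e :=
  (h.hasFDerivAt_left hp).comp e (hasFDerivAt_prodMk_left e p)

theorem hasFDerivAt_mul_right (h : IsLocalMoufangLoop m U e) (hp : p ∈ U) :
    HasFDerivAt (fun g => m (p, g)) (rightTranslation m e p) e :=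
  (h.hasFDerivAt_right hp).comp e (hasFDerivAt_prodMk_right p e)

theorem fderiv_left (h : IsLocalMoufangLoop m U e) (hp : p ∈ U) (x v : V) :
    fderiv ℝ m (e, p) (x, v) = leftTranslation m e p x + v := by
  have hcomp : HasFDerivAt (fun q => m (e, q))
      ((fderiv ℝ m (e, p)).comp (ContinuousLinearMap.inr ℝ V V)) p :=
    (h.hasFDerivAt_left hp).comp p (hasFDerivAt_prodMk_right e p)
  have hid : HasFDerivAt (fun q => m (e, q)) (ContinuousLinearMap.id ℝ V) p :=
    (hasFDerivAt_id p).congr_of_eventuallyEq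
      (mem_of_superset (U.isOpen.mem_nhds hp) fun q hq => h.one_mul q hq)
  have hv : fderiv ℝ m (e, p) (0, v) = v := congrArg (· v) (hcomp.unique hid)
  rw [leftTranslation_apply, ← Prod.fst_add_snd (x, v), map_add, hv]

theorem fderiv_right (h : IsLocalMoufangLoop m U e) (hp : p ∈ U) (v x : V) :
    fderiv ℝ m (p, e) (v, x) = v + rightTranslation m e p x := by
  have hswap : fderiv ℝ (m ∘ Prod.swap) (e, p) (x, v) = fderiv ℝ m (p, e) (v, x) :=
    congrArg (· (x, v))
      ((ContinuousLinearEquiv.prodComm ℝ V V).comp_right_fderiv (f := m) (x := (e, p)))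
  rw [← hswap, h.swap.fderiv_left hp, leftTranslation_comp_swap, add_comm]

theorem leftTranslation_one (h : IsLocalMoufangLoop m U e) :
    leftTranslation m e e = ContinuousLinearMap.id ℝ V := by
  ext x
  simp [leftTranslation_apply, h.fderiv_right h.mem]

theorem rightTranslation_one (h : IsLocalMoufangLoop m U e) :
    rightTranslation m e e = ContinuousLinearMap.id ℝ V := by
  rw [← leftTranslation_comp_swap, h.swap.leftTranslation_one]

theorem contDiffOn_leftTranslation (h : IsLocalMoufangLoop m U e) :
    ContDiffOn ℝ ∞ (leftTranslation m e) U := fun p hp => by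
  have hfderiv := (h.contDiffAt_left p hp).fderiv_right (m := ∞) (by norm_cast)
  exact ((hfderiv.comp p (contDiffAt_const.prodMk contDiffAt_id)).clm_comp
    contDiffAt_const).contDiffWithinAt

theorem contDiffOn_rightTranslation (h : IsLocalMoufangLoop m U e) :
    ContDiffOn ℝ ∞ (rightTranslation m e) U := by
  simpa only [leftTranslation_comp_swap] using h.swap.contDiffOn_leftTranslation

theorem differentiableAt_leftTranslation (h : IsLocalMoufangLoop m U e) (hp : p ∈ U) :
    DifferentiableAt ℝ (leftTranslation m e) p :=
  (h.contDiffOn_leftTranslation.contDiffAt (U.isOpen.mem_nhds hp)).differentiableAt (by simp)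

theorem differentiableAt_rightTranslation (h : IsLocalMoufangLoop m U e) (hp : p ∈ U) :
    DifferentiableAt ℝ (rightTranslation m e) p :=
  (h.contDiffOn_rightTranslation.contDiffAt (U.isOpen.mem_nhds hp)).differentiableAt (by simp)

theorem differentiableAt_inverse_leftTranslation [CompleteSpace V]
    (h : IsLocalMoufangLoop m U e) :
    DifferentiableAt ℝ (fun q => Ring.inverse (leftTranslation m e q)) e := by
  have hunit : IsUnit (leftTranslation m e e) := h.leftTranslation_one ▸ isUnit_one
  exact DifferentiableAt.comp e (g := Ring.inverse) (differentiableAt_inverse hunit)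
    (h.differentiableAt_leftTranslation h.mem)

theorem hasFDerivAt_fderiv_mul_left (h : IsLocalMoufangLoop m U e) (hp : p ∈ U) :
    HasFDerivAt (fun q => fderiv ℝ m (q, p))
      ((fderiv ℝ (fderiv ℝ m) (e, p)).comp (ContinuousLinearMap.inl ℝ V V)) e :=
  HasFDerivAt.comp (f := fun q => (q, p)) e
    (hasFDerivAt_fderiv_of_contDiffAt (h.contDiffAt_left p hp)) (hasFDerivAt_prodMk_left e p)

theorem fderiv_leftTranslation (h : IsLocalMoufangLoop m U e) (hp : p ∈ U) (v x : V) :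
    fderiv ℝ (leftTranslation m e) p v x = fderiv ℝ (fderiv ℝ m) (e, p) (0, v) (x, 0) := by
  have hfderiv := ((hasFDerivAt_fderiv_of_contDiffAt (h.contDiffAt_left p hp)).comp p
    (hasFDerivAt_prodMk_right e p)).clm_comp
      (hasFDerivAt_const (ContinuousLinearMap.inl ℝ V V) p)
  refine (congrArg (· v x) hfderiv.fderiv).trans ?_
  simp

theorem fderiv_leftTranslation_one (h : IsLocalMoufangLoop m U e) (y x : V) :
    fderiv ℝ (leftTranslation m e) e y x = mixedDerivative m e x y :=
  h.fderiv_leftTranslation h.mem y x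

theorem fderiv_rightTranslation_one (h : IsLocalMoufangLoop m U e) (y x : V) :
    fderiv ℝ (rightTranslation m e) e y x = mixedDerivative m e y x := by
  have hfderiv := (h.hasFDerivAt_fderiv_mul_left h.mem).clm_comp
    (hasFDerivAt_const (ContinuousLinearMap.inr ℝ V V) e)
  refine (congrArg (· y x) hfderiv.fderiv).trans ?_
  simpa [mixedDerivative_apply] using
    fderiv_fderiv_comm_of_contDiffAt (h.contDiffAt_left e h.mem) (y, 0) (0, x)

theorem mixedDerivative_comp_swap (h : IsLocalMoufangLoop m U e) (x y : V) :
    mixedDerivative (m ∘ Prod.swap) e x y = mixedDerivative m e y x := by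
  rw [← h.swap.fderiv_leftTranslation_one, leftTranslation_comp_swap,
    h.fderiv_rightTranslation_one]

theorem hasFDerivAt_mul_mul (h : IsLocalMoufangLoop m U e) (hp : p ∈ U) :
    HasFDerivAt (fun g => m (m (g, p), g)) (leftTranslation m e p + rightTranslation m e p) e := by
  have hpair := (h.hasFDerivAt_mul_left hp).prodMk (hasFDerivAt_id e)
  have hm := h.hasFDerivAt_right hp
  rw [← h.one_mul p hp] at hm
  refine (HasFDerivAt.comp (f := fun g => (m (g, p), g)) e hm hpair).congr_fderiv ?_
  ext x
  simp [h.one_mul p hp, h.fderiv_right hp]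

theorem hasFDerivAt_mul_mul' (h : IsLocalMoufangLoop m U e) (hp : p ∈ U) :
    HasFDerivAt (fun g => m (g, m (p, g))) (leftTranslation m e p + rightTranslation m e p) e := by
  have hswap := h.swap.hasFDerivAt_mul_mul hp
  rwa [leftTranslation_comp_swap, rightTranslation_comp_swap, add_comm] at hswap

theorem eventually_regular (h : IsLocalMoufangLoop m U e) (hp : p ∈ U) :
    ∀ᶠ q in 𝓝 e, q ∈ U ∧ m (q, p) ∈ U ∧ HasFDerivAt m (fderiv ℝ m (q, p)) (q, p) := by
  have hmul := (h.hasFDerivAt_mul_left hp).continuousAt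
  have hmk : Tendsto (fun q => (q, p)) (𝓝 e) (𝓝 (e, p)) := Continuous.tendsto (by fun_prop) e
  have hsmooth := ((h.contDiffAt_left p hp).of_le (m := 1) (by norm_cast)).eventually (by simp)
  filter_upwards [U.isOpen.mem_nhds h.mem,
    hmul (U.isOpen.mem_nhds (by simpa [h.one_mul p hp] using hp)), hmk.eventually hsmooth]
    with q hq hqp hm
  exact ⟨hq, hqp, (hm.differentiableAt one_ne_zero).hasFDerivAt⟩

theorem eventually_fderiv_middle (h : IsLocalMoufangLoop m U e) (hp : p ∈ U) :
    ∀ᶠ q in 𝓝 e, leftTranslation m e (m (q, p)) + rightTranslation m e (m (q, p)) =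
      (fderiv ℝ m (q, p)).comp ((leftTranslation m e q).prod (rightTranslation m e p)) := by
  filter_upwards [h.eventually_regular hp, (h.middle p hp).curry_nhds]
    with q ⟨hq, hqp, hm⟩ hmiddle
  have hpair := (h.hasFDerivAt_mul_left hq).prodMk (h.hasFDerivAt_mul_right hp)
  have hrhs := HasFDerivAt.comp (f := fun g => (m (g, q), m (p, g))) e
    (by rwa [h.one_mul q hq, h.mul_one p hp]) hpair
  exact (h.hasFDerivAt_mul_mul hqp).unique (hrhs.congr_of_eventuallyEq hmiddle)

theorem eventually_fderiv_right (h : IsLocalMoufangLoop m U e) (hp : p ∈ U) :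
    ∀ᶠ q in 𝓝 e, (fderiv ℝ m (q, p)).comp ((rightTranslation m e q).prod 0) +
        rightTranslation m e (m (q, p)) =
      (fderiv ℝ m (q, p)).comp
        ((0 : V →L[ℝ] V).prod (leftTranslation m e p + rightTranslation m e p)) := by
  filter_upwards [h.eventually_regular hp, (h.right p hp).curry_nhds]
    with q ⟨hq, hqp, hm⟩ hright
  have hinner := HasFDerivAt.comp (f := fun g => (m (q, g), p)) e
    (by rwa [h.mul_one q hq]) ((h.hasFDerivAt_mul_right hq).prodMk (hasFDerivAt_const p e))
  have hlhs := HasFDerivAt.comp (f := fun g => (m (m (q, g), p), g)) e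
    (by simpa only [h.mul_one q hq] using h.hasFDerivAt_right hqp)
    (hinner.prodMk (hasFDerivAt_id e))
  have hrhs := HasFDerivAt.comp (f := fun g => (q, m (g, m (p, g)))) e
    (by simpa only [h.mul_one p hp, h.one_mul p hp] using hm)
    ((hasFDerivAt_const q e).prodMk (h.hasFDerivAt_mul_mul' hp))
  rw [← hlhs.unique (hrhs.congr_of_eventuallyEq hright)]
  ext x
  simp [h.fderiv_right hqp]

theorem hasFDerivAt_comp_mul {W : Type*} [NormedAddCommGroup W] [NormedSpace ℝ W] {F : V → W}
    (h : IsLocalMoufangLoop m U e) (hp : p ∈ U) (hF : DifferentiableAt ℝ F p) :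
    HasFDerivAt (fun q => F (m (q, p))) ((fderiv ℝ F p).comp (leftTranslation m e p)) e :=
  HasFDerivAt.comp (g := F) e (by rw [h.one_mul p hp]; exact hF.hasFDerivAt)
    (h.hasFDerivAt_mul_left hp)

theorem middle_relation (h : IsLocalMoufangLoop m U e) (hp : p ∈ U) (x y : V) :
    fderiv ℝ (leftTranslation m e) p (leftTranslation m e p y) x +
        fderiv ℝ (rightTranslation m e) p (leftTranslation m e p y) x =
      leftTranslation m e p (mixedDerivative m e x y) +
        (fderiv ℝ (fderiv ℝ m) (e, p) (y, 0) (x, 0) +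
          fderiv ℝ (leftTranslation m e) p (rightTranslation m e p x) y) := by
  have hlhs := (h.hasFDerivAt_comp_mul hp (h.differentiableAt_leftTranslation hp)).add
    (h.hasFDerivAt_comp_mul hp (h.differentiableAt_rightTranslation hp))
  have hpair := ((h.differentiableAt_leftTranslation h.mem).hasFDerivAt.clm_apply
    (hasFDerivAt_const x e)).prodMk (hasFDerivAt_const (rightTranslation m e p x) e)
  have hrhs := (h.hasFDerivAt_fderiv_mul_left hp).clm_apply hpair
  have heq := (hlhs.clm_apply (hasFDerivAt_const x e)).unique (hrhs.congr_of_eventuallyEq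
    ((h.eventually_fderiv_middle hp).mono fun q hq => congrArg (· x) hq))
  have hsplit := map_add (fderiv ℝ (fderiv ℝ m) (e, p) (y, 0)) (x, 0)
    (0, rightTranslation m e p x)
  rw [Prod.mk_add_mk, add_zero, zero_add, fderiv_fderiv_comm_of_contDiffAt
    (h.contDiffAt_left p hp) (y, 0) (0, _), ← h.fderiv_leftTranslation hp] at hsplit
  rw [← hsplit, ← h.fderiv_leftTranslation_one]
  simpa [h.fderiv_left hp, h.leftTranslation_one] using congrArg (· y) heq

theorem right_relation (h : IsLocalMoufangLoop m U e) (hp : p ∈ U) (x y : V) :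
    leftTranslation m e p (mixedDerivative m e y x) + fderiv ℝ (fderiv ℝ m) (e, p) (y, 0) (x, 0) +
        fderiv ℝ (rightTranslation m e) p (leftTranslation m e p y) x =
      fderiv ℝ (leftTranslation m e) p (leftTranslation m e p x + rightTranslation m e p x) y := by
  have hpair := ((h.differentiableAt_rightTranslation h.mem).hasFDerivAt.clm_apply
    (hasFDerivAt_const x e)).prodMk (hasFDerivAt_const (0 : V) e)
  have hlhs := ((h.hasFDerivAt_fderiv_mul_left hp).clm_apply hpair).add
    ((h.hasFDerivAt_comp_mul hp (h.differentiableAt_rightTranslation hp)).clm_apply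
      (hasFDerivAt_const x e))
  have hrhs := (h.hasFDerivAt_fderiv_mul_left hp).clm_apply
    (hasFDerivAt_const ((0 : V), leftTranslation m e p x + rightTranslation m e p x) e)
  have heq := hlhs.unique (hrhs.congr_of_eventuallyEq
    ((h.eventually_fderiv_right hp).mono fun q hq => congrArg (· x) hq))
  rw [h.fderiv_leftTranslation hp, fderiv_fderiv_comm_of_contDiffAt
    (h.contDiffAt_left p hp) (0, _), ← h.fderiv_rightTranslation_one]
  simpa [h.fderiv_left hp, h.rightTranslation_one] using congrArg (· y) heq

theorem lieBracket_left_left (h : IsLocalMoufangLoop m U e) (hp : p ∈ U) (x y : V) :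
    lieBracket ℝ (leftTranslation m e · x) (leftTranslation m e · y) p =
      fderiv ℝ (leftTranslation m e) p (leftTranslation m e p x) y -
        fderiv ℝ (leftTranslation m e) p (leftTranslation m e p y) x := by
  simp [lieBracket, fderiv_clm_apply (h.differentiableAt_leftTranslation hp)]

theorem lieBracket_left_right (h : IsLocalMoufangLoop m U e) (hp : p ∈ U) (x y : V) :
    lieBracket ℝ (leftTranslation m e · x) (rightTranslation m e · y) p =
      fderiv ℝ (rightTranslation m e) p (leftTranslation m e p x) y -
        fderiv ℝ (leftTranslation m e) p (rightTranslation m e p y) x := by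
  simp [lieBracket, fderiv_clm_apply (h.differentiableAt_leftTranslation hp),
    fderiv_clm_apply (h.differentiableAt_rightTranslation hp)]

theorem lieBracket_left_right_antisymm (h : IsLocalMoufangLoop m U e) (hp : p ∈ U) (x y : V) :
    lieBracket ℝ (leftTranslation m e · x) (rightTranslation m e · y) p =
      -lieBracket ℝ (leftTranslation m e · y) (rightTranslation m e · x) p := by
  have hmiddle := h.middle_relation hp y x
  have hright := h.right_relation hp x y
  rw [fderiv_fderiv_comm_of_contDiffAt (h.contDiffAt_left p hp) (y, 0), map_add,
    add_apply] at hright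
  rw [h.lieBracket_left_right hp, h.lieBracket_left_right hp]
  linear_combination (norm := module) hmiddle + hright

theorem lieBracket_left_left_eq (h : IsLocalMoufangLoop m U e) (hp : p ∈ U) (x y : V) :
    lieBracket ℝ (leftTranslation m e · x) (leftTranslation m e · y) p =
      -leftTranslation m e p (tangentProduct m e x y) -
        (2 : ℝ) • lieBracket ℝ (leftTranslation m e · x) (rightTranslation m e · y) p := by
  have hmiddle := h.middle_relation hp x y
  have hright := h.right_relation hp x y
  rw [map_add, add_apply] at hright
  rw [h.lieBracket_left_right_antisymm hp, h.lieBracket_left_right hp, h.lieBracket_left_left hp,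
    tangentProduct_apply, map_sub]
  linear_combination (norm := module) -hmiddle - hright

theorem eventually_fderiv_commutator (h : IsLocalMoufangLoop m U e) {q : V × V → V}
    (hq : ContDiffAt ℝ ∞ q (e, e)) (hq_one : ∀ᶠ x in 𝓝 e, q (x, e) = e)
    (hqm : ∀ᶠ z : V × V in 𝓝 (e, e), m (m (q z, z.2), z.1) = m z) :
    ∀ᶠ x in 𝓝 e, ∀ y,
      leftTranslation m e x (fderiv ℝ q (x, e) (0, y) + y) = rightTranslation m e x y := by
  have hmk : Tendsto (fun x : V => (x, e)) (𝓝 e) (𝓝 (e, e)) := Continuous.tendsto (by fun_prop) e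
  have hsmooth := (hq.of_le (m := 1) (by norm_cast)).eventually (by simp)
  filter_upwards [U.isOpen.mem_nhds h.mem, hmk.eventually hsmooth, hq_one, hqm.curry_nhds]
    with x hx hqx hqx_one hmul y
  have hinner : HasFDerivAt (fun g => q (x, g))
      ((fderiv ℝ q (x, e)).comp (ContinuousLinearMap.inr ℝ V V)) e :=
    (hqx.differentiableAt one_ne_zero).hasFDerivAt.comp e (hasFDerivAt_prodMk_right x e)
  have hmiddle := HasFDerivAt.comp (f := fun g => (q (x, g), g)) e
    (by rw [hqx_one]; exact h.hasFDerivAt_left h.mem) (hinner.prodMk (hasFDerivAt_id e))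
  have houter := HasFDerivAt.comp (f := fun g => m (q (x, g), g)) e
    (by rw [hqx_one, h.one_mul e h.mem]; exact h.hasFDerivAt_mul_left hx) hmiddle
  have heq := (houter.congr_of_eventuallyEq (hmul.mono fun _ hg => hg.symm)).unique
    (h.hasFDerivAt_mul_right hx)
  simpa [h.fderiv_left h.mem, h.leftTranslation_one] using congrArg (· y) heq

-- The condition on `q` says that `q (g, h) = (g h g⁻¹) h⁻¹`, without mentioning inverses.
theorem fderiv_fderiv_commutator (h : IsLocalMoufangLoop m U e) {q : V × V → V}
    (hq : ContDiffAt ℝ ∞ q (e, e)) (hq_one : ∀ᶠ x in 𝓝 e, q (x, e) = e)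
    (hqm : ∀ᶠ z : V × V in 𝓝 (e, e), m (m (q z, z.2), z.1) = m z) (x y : V) :
    fderiv ℝ (fderiv ℝ q) (e, e) (x, 0) (0, y) = tangentProduct m e x y := by
  have hfderiv := h.eventually_fderiv_commutator hq hq_one hqm
  have hzero : fderiv ℝ q (e, e) (0, y) = 0 := by
    simpa [h.leftTranslation_one, h.rightTranslation_one] using hfderiv.self_of_nhds y
  have hq' := (HasFDerivAt.comp (f := fun z => (z, e)) e (hasFDerivAt_fderiv_of_contDiffAt hq)
    (hasFDerivAt_prodMk_left e e)).clm_apply (hasFDerivAt_const ((0, y) : V × V) e)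
  have hlhs := (h.differentiableAt_leftTranslation h.mem).hasFDerivAt.clm_apply (hq'.add_const y)
  have hrhs := (h.differentiableAt_rightTranslation h.mem).hasFDerivAt.clm_apply
    (hasFDerivAt_const y e)
  have heq := hlhs.unique (hrhs.congr_of_eventuallyEq (hfderiv.mono fun _ hz => hz y))
  simpa [h.leftTranslation_one, hzero, h.fderiv_leftTranslation_one,
    h.fderiv_rightTranslation_one, tangentProduct_apply, eq_sub_iff_add_eq]
    using congrArg (· x) heq

end IsLocalMoufangLoop
end LocalLoop

/-! ### The tangent algebra of a local Moufang loop -/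

section TangentAlgebra

open Filter Topology TopologicalSpace VectorField

variable {V : Type*} [NormedAddCommGroup V] [NormedSpace ℝ V]

/-- The smooth vector fields on an open subset `U` of a normed space. They are extended by zero
outside `U`, so that equality of vector fields is equality on `U`. -/
def smoothVectorFields (U : Opens V) : Submodule ℝ (V → V) where
  carrier := {X | ContDiffOn ℝ ∞ X U ∧ ∀ p ∉ U, X p = 0}
  zero_mem' := ⟨contDiffOn_const, fun _ _ => rfl⟩
  add_mem' hX hY := ⟨hX.1.add hY.1, fun p hp => by simp [hX.2 p hp, hY.2 p hp]⟩
  smul_mem' c _ hX := ⟨hX.1.const_smul c, fun p hp => by simp [hX.2 p hp]⟩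

/-- The Lie algebra of smooth vector fields on `U`. -/
abbrev SmoothVectorField (U : Opens V) : Type _ := smoothVectorFields U

namespace SmoothVectorField

variable {U : Opens V} {p : V}

@[ext]
theorem ext {X Y : SmoothVectorField U} (h : ∀ p ∈ U, X.1 p = Y.1 p) : X = Y := by
  refine Subtype.ext (funext fun p => ?_)
  by_cases hp : p ∈ U
  exacts [h p hp, (X.2.2 p hp).trans (Y.2.2 p hp).symm]

/-- The restriction to `U` of a vector field that is smooth on `U`. -/
def restrict {X : V → V} (hX : ContDiffOn ℝ ∞ X U) : SmoothVectorField U :=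
  ⟨(U : Set V).indicator X, hX.congr fun _ hp => Set.indicator_of_mem hp X,
    fun _ hp => Set.indicator_of_notMem hp X⟩

theorem restrict_apply {X : V → V} (hX : ContDiffOn ℝ ∞ X U) (hp : p ∈ U) :
    (restrict hX).1 p = X p :=
  Set.indicator_of_mem hp X

theorem restrict_eventuallyEq {X : V → V} (hX : ContDiffOn ℝ ∞ X U) (hp : p ∈ U) :
    (restrict hX).1 =ᶠ[𝓝 p] X :=
  mem_of_superset (U.isOpen.mem_nhds hp) fun _ => restrict_apply hX

theorem contDiffAt (X : SmoothVectorField U) (hp : p ∈ U) : ContDiffAt ℝ ∞ X.1 p :=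
  X.2.1.contDiffAt (U.isOpen.mem_nhds hp)

theorem differentiableAt (X : SmoothVectorField U) (hp : p ∈ U) : DifferentiableAt ℝ X.1 p :=
  (X.contDiffAt hp).differentiableAt (by simp)

theorem contDiffOn_lieBracket (X Y : SmoothVectorField U) :
    ContDiffOn ℝ ∞ (lieBracket ℝ X.1 Y.1) U := fun _ hp =>
  ((X.contDiffAt hp).lieBracket_vectorField (Y.contDiffAt hp)
    (by norm_cast)).contDiffWithinAt

instance : Bracket (SmoothVectorField U) (SmoothVectorField U) :=
  ⟨fun X Y => restrict (contDiffOn_lieBracket X Y)⟩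

theorem bracket_apply (X Y : SmoothVectorField U) (hp : p ∈ U) :
    (⁅X, Y⁆ : SmoothVectorField U).1 p = lieBracket ℝ X.1 Y.1 p :=
  restrict_apply _ hp

theorem bracket_eventuallyEq (X Y : SmoothVectorField U) (hp : p ∈ U) :
    (⁅X, Y⁆ : SmoothVectorField U).1 =ᶠ[𝓝 p] lieBracket ℝ X.1 Y.1 :=
  restrict_eventuallyEq _ hp

instance : LieRing (SmoothVectorField U) where
  add_lie X Y Z := by
    ext p hp
    simp [bracket_apply _ _ hp, lieBracket_add_left (X.differentiableAt hp)
      (Y.differentiableAt hp)]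
  lie_add X Y Z := by
    ext p hp
    simp [bracket_apply _ _ hp, lieBracket_add_right (Y.differentiableAt hp)
      (Z.differentiableAt hp)]
  lie_self X := by
    ext p hp
    simp [bracket_apply _ _ hp]
  leibniz_lie X Y Z := by
    ext p hp
    have hrefl (W : SmoothVectorField U) : W.1 =ᶠ[𝓝 p] W.1 := .rfl
    simp only [Submodule.coe_add, Pi.add_apply, bracket_apply _ _ hp]
    rw [(hrefl X).lieBracket_vectorField_eq (bracket_eventuallyEq Y Z hp),
      (bracket_eventuallyEq X Y hp).lieBracket_vectorField_eq (hrefl Z),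
      (hrefl Y).lieBracket_vectorField_eq (bracket_eventuallyEq X Z hp)]
    exact leibniz_identity_lieBracket (n := ∞)
      (by simpa using WithTop.coe_le_coe.2 (le_top : (2 : ℕ∞) ≤ ⊤))
      (X.contDiffAt hp) (Y.contDiffAt hp) (Z.contDiffAt hp)

instance : LieAlgebra ℝ (SmoothVectorField U) where
  lie_smul c X Y := by
    ext p hp
    simp [bracket_apply _ _ hp, lieBracket_const_smul_right (Y.differentiableAt hp)]

/-- The linear family `x ↦ (p ↦ A p x)` of vector fields given by a smooth operator-valued
function `A`. -/
def ofOperators {A : V → V →L[ℝ] V} (hA : ContDiffOn ℝ ∞ A U) : V →ₗ[ℝ] SmoothVectorField U where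
  toFun x := restrict (hA.clm_apply (contDiffOn_const (c := x)))
  map_add' x y := by
    ext p hp
    simp [restrict_apply _ hp]
  map_smul' c x := by
    ext p hp
    simp [restrict_apply _ hp]

theorem ofOperators_apply {A : V → V →L[ℝ] V} (hA : ContDiffOn ℝ ∞ A U) (x : V) (hp : p ∈ U) :
    (ofOperators hA x).1 p = A p x :=
  restrict_apply (hA.clm_apply contDiffOn_const) hp

theorem lie_ofOperators_apply {A B : V → V →L[ℝ] V} (hA : ContDiffOn ℝ ∞ A U)
    (hB : ContDiffOn ℝ ∞ B U) (x y : V) (hp : p ∈ U) :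
    (⁅ofOperators hA x, ofOperators hB y⁆ : SmoothVectorField U).1 p =
      lieBracket ℝ (A · x) (B · y) p :=
  (bracket_apply _ _ hp).trans <|
    (restrict_eventuallyEq (hA.clm_apply contDiffOn_const) hp).lieBracket_vectorField_eq
      (restrict_eventuallyEq (hB.clm_apply contDiffOn_const) hp)

end SmoothVectorField

namespace IsLocalMoufangLoop

variable {m : V × V → V} {U : Opens V} {e : V}

/-- The infinitesimal left translations, as vector fields on `U`. -/
def leftField (h : IsLocalMoufangLoop m U e) : V →ₗ[ℝ] SmoothVectorField U :=
  SmoothVectorField.ofOperators h.contDiffOn_leftTranslation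

/-- The infinitesimal right translations, as vector fields on `U`. -/
def rightField (h : IsLocalMoufangLoop m U e) : V →ₗ[ℝ] SmoothVectorField U :=
  SmoothVectorField.ofOperators h.contDiffOn_rightTranslation

theorem leftField_swap (h : IsLocalMoufangLoop m U e) : h.swap.leftField = h.rightField := by
  simp only [leftField, rightField, leftTranslation_comp_swap]

theorem rightField_swap (h : IsLocalMoufangLoop m U e) : h.swap.rightField = h.leftField := by
  simp only [leftField, rightField, rightTranslation_comp_swap]

theorem tangentProduct_comp_swap (h : IsLocalMoufangLoop m U e) (x y : V) :
    tangentProduct (m ∘ Prod.swap) e x y = -tangentProduct m e x y := by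
  simp [tangentProduct_apply, h.mixedDerivative_comp_swap]

theorem lie_leftField_rightField_antisymm (h : IsLocalMoufangLoop m U e) (x y : V) :
    ⁅h.leftField x, h.rightField y⁆ = -⁅h.leftField y, h.rightField x⁆ := by
  ext p hp
  simpa only [Submodule.coe_neg, Pi.neg_apply, leftField, rightField,
    SmoothVectorField.lie_ofOperators_apply _ _ _ _ hp] using
    h.lieBracket_left_right_antisymm hp x y

theorem lie_leftField (h : IsLocalMoufangLoop m U e) (x y : V) :
    ⁅h.leftField x, h.leftField y⁆ =
      -h.leftField (tangentProduct m e x y) - (2 : ℝ) • ⁅h.leftField x, h.rightField y⁆ := by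
  ext p hp
  simpa only [Submodule.coe_sub, Submodule.coe_neg, Submodule.coe_smul, Pi.sub_apply, Pi.neg_apply,
    Pi.smul_apply, leftField, rightField, SmoothVectorField.lie_ofOperators_apply _ _ _ _ hp,
    SmoothVectorField.ofOperators_apply _ _ hp] using h.lieBracket_left_left_eq hp x y

theorem lie_rightField (h : IsLocalMoufangLoop m U e) (x y : V) :
    ⁅h.rightField x, h.rightField y⁆ =
      h.rightField (tangentProduct m e x y) - (2 : ℝ) • ⁅h.leftField x, h.rightField y⁆ := by
  have hswap := h.swap.lie_leftField x y
  rwa [h.leftField_swap, h.rightField_swap, h.tangentProduct_comp_swap, map_neg, neg_neg,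
    ← lie_skew (h.rightField x) (h.leftField y), ← h.lie_leftField_rightField_antisymm] at hswap

-- In a Lie group `leftField x` is right-invariant, so that `-leftField` is the Lie homomorphism.
theorem isTranslationPair (h : IsLocalMoufangLoop m U e) :
    IsTranslationPair (tangentProduct m e) (-h.leftField) (-h.rightField) where
  lie_left x y := by simp [h.lie_leftField, sub_eq_add_neg]
  lie_right x y := by simp [h.lie_rightField]
  lie_swap x y := by simp [h.lie_leftField_rightField_antisymm x y]

theorem leftField_injective (h : IsLocalMoufangLoop m U e) : Function.Injective h.leftField := by
  intro x y hxy
  have hval (v : V) : (h.leftField v).1 e = v := by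
    rw [leftField, SmoothVectorField.ofOperators_apply _ _ h.mem, h.leftTranslation_one,
      ContinuousLinearMap.id_apply]
  rw [← hval x, hxy, hval]

theorem isMaltsevBracket_tangentProduct (h : IsLocalMoufangLoop m U e) :
    IsMaltsevBracket (tangentProduct m e · ·) :=
  h.isTranslationPair.isMaltsevBracket (neg_injective.comp h.leftField_injective)

end IsLocalMoufangLoop
end TangentAlgebra

/-! ### Birepresentations of local Moufang loops -/

section LocalBirepresentation

open Filter Topology TopologicalSpace

attribute [local instance] LieRing.ofAssociativeRing

variable {V : Type*} [NormedAddCommGroup V] [NormedSpace ℝ V]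
  {A : Type*} [NormedRing A] [NormedAlgebra ℝ A]

/-- A differentiable birepresentation of a local Moufang loop in a normed algebra. The primed
identities follow from the unprimed ones for a global loop, by cancellation. -/
structure IsLocalBirepresentation (m : V × V → V) (e : V) (S T : V → A) : Prop where
  left_one : S e = 1
  right_one : T e = 1
  left_differentiable : ∀ᶠ q in 𝓝 e, DifferentiableAt ℝ S q
  right_differentiable : ∀ᶠ q in 𝓝 e, DifferentiableAt ℝ T q
  left_mul : ∀ᶠ z : V × V in 𝓝 (e, e), T z.2 * S z.2 * S z.1 = S (m (z.2, z.1)) * T z.2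
  left_mul' : ∀ᶠ z : V × V in 𝓝 (e, e), T z.2 * S (m (z.1, z.2)) = S z.1 * (T z.2 * S z.2)
  right_mul : ∀ᶠ z : V × V in 𝓝 (e, e), S z.2 * T z.2 * T z.1 = T (m (z.1, z.2)) * S z.2
  right_mul' : ∀ᶠ z : V × V in 𝓝 (e, e), S z.2 * T (m (z.2, z.1)) = T z.1 * (S z.2 * T z.2)

namespace IsLocalBirepresentation

variable {m : V × V → V} {U : Opens V} {e : V} {S T : V → A}

theorem swap (hST : IsLocalBirepresentation m e S T) :
    IsLocalBirepresentation (m ∘ Prod.swap) e T S where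
  left_one := hST.right_one
  right_one := hST.left_one
  left_differentiable := hST.right_differentiable
  right_differentiable := hST.left_differentiable
  left_mul := hST.right_mul
  left_mul' := hST.right_mul'
  right_mul := hST.left_mul
  right_mul' := hST.left_mul'

theorem hasFDerivAt_left (hST : IsLocalBirepresentation m e S T) :
    HasFDerivAt S (fderiv ℝ S e) e :=
  hST.left_differentiable.self_of_nhds.hasFDerivAt

theorem hasFDerivAt_right (hST : IsLocalBirepresentation m e S T) :
    HasFDerivAt T (fderiv ℝ T e) e :=
  hST.right_differentiable.self_of_nhds.hasFDerivAt

theorem eventually_fderiv_leftTranslation (hST : IsLocalBirepresentation m e S T)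
    (h : IsLocalMoufangLoop m U e) :
    ∀ᶠ q in 𝓝 e, ∀ x, fderiv ℝ S q (leftTranslation m e q x) =
      (fderiv ℝ T e x + fderiv ℝ S e x) * S q - S q * fderiv ℝ T e x := by
  filter_upwards [U.isOpen.mem_nhds h.mem, hST.left_differentiable, hST.left_mul.curry_nhds]
    with q hq hdiff hmul x
  have hlhs := (hST.hasFDerivAt_right.mul' hST.hasFDerivAt_left).mul_const' (S q)
  have hrhs := (HasFDerivAt.comp (g := S) e (by rw [h.one_mul q hq]; exact hdiff.hasFDerivAt)
    (h.hasFDerivAt_mul_left hq)).mul' hST.hasFDerivAt_right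
  have heq := congrArg (· x) (hlhs.unique (hrhs.congr_of_eventuallyEq hmul))
  simp only [hST.left_one, hST.right_one, Function.comp_apply, h.one_mul q hq, add_apply,
    smul_apply, ContinuousLinearMap.comp_apply, smul_eq_mul, MulOpposite.op_one, one_smul,
    MulOpposite.smul_eq_mul_unop, MulOpposite.unop_op] at heq
  linear_combination (norm := noncomm_ring) -heq

theorem eventually_fderiv_rightTranslation (hST : IsLocalBirepresentation m e S T)
    (h : IsLocalMoufangLoop m U e) :
    ∀ᶠ q in 𝓝 e, ∀ x, fderiv ℝ S q (rightTranslation m e q x) =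
      S q * (fderiv ℝ T e x + fderiv ℝ S e x) - fderiv ℝ T e x * S q := by
  filter_upwards [U.isOpen.mem_nhds h.mem, hST.left_differentiable, hST.left_mul'.curry_nhds]
    with q hq hdiff hmul x
  have hlhs := hST.hasFDerivAt_right.mul' (HasFDerivAt.comp (g := S) e
    (by rw [h.mul_one q hq]; exact hdiff.hasFDerivAt) (h.hasFDerivAt_mul_right hq))
  have hrhs := (hST.hasFDerivAt_right.mul' hST.hasFDerivAt_left).const_mul (S q)
  have heq := congrArg (· x) (hlhs.unique (hrhs.congr_of_eventuallyEq hmul))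
  simp only [hST.left_one, hST.right_one, Function.comp_apply, h.mul_one q hq, add_apply,
    smul_apply, ContinuousLinearMap.comp_apply, smul_eq_mul, MulOpposite.op_one, one_smul,
    MulOpposite.smul_eq_mul_unop, MulOpposite.unop_op] at heq
  linear_combination (norm := noncomm_ring) heq

-- The left equation determines the derivative of `S` because left translations are invertible
-- near the unit, so that a merely differentiable `S` is automatically twice differentiable there.
theorem differentiableAt_fderiv [CompleteSpace V] (hST : IsLocalBirepresentation m e S T)
    (h : IsLocalMoufangLoop m U e) : DifferentiableAt ℝ (fderiv ℝ S) e := by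
  let Ψ : V → V →L[ℝ] A := fun q =>
    ((ContinuousLinearMap.mul ℝ A).flip (S q)).comp (fderiv ℝ T e + fderiv ℝ S e) -
      (ContinuousLinearMap.mul ℝ A (S q)).comp (fderiv ℝ T e)
  have hS := hST.hasFDerivAt_left.differentiableAt
  have hΨ : DifferentiableAt ℝ Ψ e :=
    (((ContinuousLinearMap.mul ℝ A).flip.differentiableAt.comp e hS).clm_comp
      (differentiableAt_const _)).sub
    (((ContinuousLinearMap.mul ℝ A).differentiableAt.comp e hS).clm_comp
      (differentiableAt_const _))
  have hunit : ∀ᶠ q in 𝓝 e, IsUnit (leftTranslation m e q) :=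
    (h.differentiableAt_leftTranslation h.mem).continuousAt.eventually
      (Units.isOpen.mem_nhds (h.leftTranslation_one ▸ isUnit_one))
  refine (hΨ.clm_comp h.differentiableAt_inverse_leftTranslation).congr_of_eventuallyEq ?_
  filter_upwards [hunit, hST.eventually_fderiv_leftTranslation h] with q hq heq
  have hcomp : (fderiv ℝ S q).comp (leftTranslation m e q) = Ψ q := ContinuousLinearMap.ext heq
  have hcancel : (leftTranslation m e q).comp (Ring.inverse (leftTranslation m e q)) =
      ContinuousLinearMap.id ℝ V := Ring.mul_inverse_cancel _ hq
  rw [← hcomp, ContinuousLinearMap.comp_assoc, hcancel, ContinuousLinearMap.comp_id]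

theorem fderiv_fderiv_comm [CompleteSpace V] (hST : IsLocalBirepresentation m e S T)
    (h : IsLocalMoufangLoop m U e) (x y : V) :
    fderiv ℝ (fderiv ℝ S) e x y = fderiv ℝ (fderiv ℝ S) e y x :=
  second_derivative_symmetric_of_eventually
    (hST.left_differentiable.mono fun _ hq => hq.hasFDerivAt)
    (hST.differentiableAt_fderiv h).hasFDerivAt x y

theorem left_relation [CompleteSpace V] (hST : IsLocalBirepresentation m e S T)
    (h : IsLocalMoufangLoop m U e) (x y : V) :
    fderiv ℝ (fderiv ℝ S) e y x + fderiv ℝ S e (mixedDerivative m e x y) =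
      (fderiv ℝ T e x + fderiv ℝ S e x) * fderiv ℝ S e y - fderiv ℝ S e y * fderiv ℝ T e x := by
  have hL := (h.differentiableAt_leftTranslation h.mem).hasFDerivAt.clm_apply
    (hasFDerivAt_const x e)
  have hlhs := (hST.differentiableAt_fderiv h).hasFDerivAt.clm_apply hL
  have hrhs := (hST.hasFDerivAt_left.const_mul (fderiv ℝ T e x + fderiv ℝ S e x)).sub
    (hST.hasFDerivAt_left.mul_const' (fderiv ℝ T e x))
  have heq := hlhs.unique (hrhs.congr_of_eventuallyEq
    ((hST.eventually_fderiv_leftTranslation h).mono fun q hq => hq x))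
  simpa [h.leftTranslation_one, h.fderiv_leftTranslation_one, add_comm] using congrArg (· y) heq

theorem right_relation [CompleteSpace V] (hST : IsLocalBirepresentation m e S T)
    (h : IsLocalMoufangLoop m U e) (x y : V) :
    fderiv ℝ (fderiv ℝ S) e y x + fderiv ℝ S e (mixedDerivative m e y x) =
      fderiv ℝ S e y * (fderiv ℝ T e x + fderiv ℝ S e x) - fderiv ℝ T e x * fderiv ℝ S e y := by
  have hR := (h.differentiableAt_rightTranslation h.mem).hasFDerivAt.clm_apply
    (hasFDerivAt_const x e)
  have hlhs := (hST.differentiableAt_fderiv h).hasFDerivAt.clm_apply hR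
  have hrhs := (hST.hasFDerivAt_left.mul_const' (fderiv ℝ T e x + fderiv ℝ S e x)).sub
    (hST.hasFDerivAt_left.const_mul (fderiv ℝ T e x))
  have heq := hlhs.unique (hrhs.congr_of_eventuallyEq
    ((hST.eventually_fderiv_rightTranslation h).mono fun q hq => hq x))
  simpa [h.rightTranslation_one, h.fderiv_rightTranslation_one, add_comm] using
    congrArg (· y) heq

theorem lie_left_right_comm [CompleteSpace V] (hST : IsLocalBirepresentation m e S T)
    (h : IsLocalMoufangLoop m U e) (x y : V) :
    ⁅fderiv ℝ S e x, fderiv ℝ T e y⁆ = ⁅fderiv ℝ T e x, fderiv ℝ S e y⁆ := by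
  have hleft := hST.left_relation h x y
  have hright := hST.right_relation h y x
  have hsymm := hST.fderiv_fderiv_comm h x y
  simp only [Ring.lie_def]
  linear_combination (norm := noncomm_ring) hleft - hright + hsymm

theorem lie_left_left [CompleteSpace V] (hST : IsLocalBirepresentation m e S T)
    (h : IsLocalMoufangLoop m U e) (x y : V) :
    ⁅fderiv ℝ S e x, fderiv ℝ S e y⁆ =
      fderiv ℝ S e (tangentProduct m e x y) - (2 : ℝ) • ⁅fderiv ℝ S e x, fderiv ℝ T e y⁆ := by
  have hxy := hST.left_relation h x y
  have hyx := hST.left_relation h y x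
  have hsymm := hST.fderiv_fderiv_comm h x y
  have hcomm := hST.lie_left_right_comm h x y
  rw [two_smul, tangentProduct_apply, map_sub]
  simp only [Ring.lie_def] at hcomm ⊢
  linear_combination (norm := noncomm_ring) hyx - hxy - hsymm + hcomm

theorem isTranslationPair [CompleteSpace V] (hST : IsLocalBirepresentation m e S T)
    (h : IsLocalMoufangLoop m U e) :
    IsTranslationPair (tangentProduct m e) (fderiv ℝ S e : V →ₗ[ℝ] A)
      (fderiv ℝ T e : V →ₗ[ℝ] A) where
  lie_left := hST.lie_left_left h
  lie_right x y := by
    have hswap := hST.swap.lie_left_left h.swap x y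
    rw [hST.swap.lie_left_right_comm h.swap, h.tangentProduct_comp_swap, map_neg] at hswap
    exact hswap
  lie_swap := hST.lie_left_right_comm h

end IsLocalBirepresentation
end LocalBirepresentation

/-! ### Local coordinates -/

section Chart

open Filter Topology TopologicalSpace

variable {V G X : Type*} [TopologicalSpace G]

/-- The multiplication in the coordinates given by a chart. -/
def chartMul [Mul G] [TopologicalSpace V] (φ : OpenPartialHomeomorph G V) (z : V × V) : V :=
  φ (φ.symm z.1 * φ.symm z.2)

/-- The commutator `g h g⁻¹ h⁻¹` in the coordinates given by a chart. -/
def chartCommutator [Mul G] [Inv G] [TopologicalSpace V] (φ : OpenPartialHomeomorph G V)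
    (z : V × V) : V :=
  φ (φ.symm z.1 * φ.symm z.2 * (φ.symm z.1)⁻¹ * (φ.symm z.2)⁻¹)

theorem chartCommutator_one_right [MoufangLoop G] [TopologicalSpace V]
    {φ : OpenPartialHomeomorph G V} (hφ1 : (1 : G) ∈ φ.source) (x : V) :
    chartCommutator φ (x, φ 1) = φ 1 := by
  have hone : (1 : G)⁻¹ = 1 := by rw [← MoufangLoop.one_mul' (1 : G)⁻¹, MoufangLoop.mul_inv']
  simp only [chartCommutator, φ.left_inv hφ1, hone, MoufangLoop.mul_one', MoufangLoop.mul_inv']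

/-- The family `a` consists, eventually along `l`, of the coordinates in the chart `φ` of a
family `A` of points tending to the point `P` of the domain of the chart. Such families are closed
under multiplication, so that identities between points yield identities between coordinates. -/
structure IsCoordinateFamily [TopologicalSpace V] (φ : OpenPartialHomeomorph G V) (l : Filter X)
    (a : X → V) (A : X → G) (P : G) : Prop where
  mem_source : P ∈ φ.source
  tendsto : Tendsto A l (𝓝 P)
  eventuallyEq : a =ᶠ[l] φ ∘ A

namespace IsCoordinateFamily

variable [TopologicalSpace V] {φ : OpenPartialHomeomorph G V} {l : Filter X} {a b : X → V}
  {A B : X → G} {P Q : G}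

theorem of_tendsto (hP : P ∈ φ.source) (hA : Tendsto A l (𝓝 P)) :
    IsCoordinateFamily φ l (φ ∘ A) A P :=
  ⟨hP, hA, .rfl⟩

theorem symm_comp (hP : P ∈ φ.source) (ha : Tendsto a l (𝓝 (φ P))) :
    IsCoordinateFamily φ l a (φ.symm ∘ a) P where
  mem_source := hP
  tendsto := (φ.tendsto_symm hP).comp ha
  eventuallyEq := (ha.eventually (φ.open_target.mem_nhds (φ.map_source hP))).mono
    fun _ hx => (φ.right_inv hx).symm

theorem eventually_symm_eq (ha : IsCoordinateFamily φ l a A P) : φ.symm ∘ a =ᶠ[l] A := by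
  filter_upwards [ha.eventuallyEq, ha.tendsto.eventually (φ.open_source.mem_nhds ha.mem_source)]
    with x hx hsource
  rw [Function.comp_apply, hx, Function.comp_apply, φ.left_inv hsource]

theorem eventuallyEq_of_eq (ha : IsCoordinateFamily φ l a A P)
    (hb : IsCoordinateFamily φ l b B Q) (h : ∀ x, A x = B x) : a =ᶠ[l] b := by
  filter_upwards [ha.eventuallyEq, hb.eventuallyEq] with x hax hbx
  rw [hax, hbx, Function.comp_apply, Function.comp_apply, h]

theorem mul [Mul G] [ContinuousMul G] (ha : IsCoordinateFamily φ l a A P)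
    (hb : IsCoordinateFamily φ l b B Q) (hPQ : P * Q ∈ φ.source) :
    IsCoordinateFamily φ l (fun x => chartMul φ (a x, b x)) (fun x => A x * B x) (P * Q) where
  mem_source := hPQ
  tendsto := ha.tendsto.mul hb.tendsto
  eventuallyEq := by
    filter_upwards [ha.eventually_symm_eq, hb.eventually_symm_eq] with x hax hbx
    exact congrArg φ (congrArg₂ (· * ·) hax hbx)

variable [MoufangLoop G] [ContinuousMul G]

theorem one_mul (ha : IsCoordinateFamily φ l a A 1) (hb : IsCoordinateFamily φ l b B Q) :
    IsCoordinateFamily φ l (fun x => chartMul φ (a x, b x)) (fun x => A x * B x) Q := by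
  simpa only [MoufangLoop.one_mul'] using
    ha.mul hb ((MoufangLoop.one_mul' Q).symm ▸ hb.mem_source)

theorem mul_one (ha : IsCoordinateFamily φ l a A P) (hb : IsCoordinateFamily φ l b B 1) :
    IsCoordinateFamily φ l (fun x => chartMul φ (a x, b x)) (fun x => A x * B x) P := by
  simpa only [MoufangLoop.mul_one'] using
    ha.mul hb ((MoufangLoop.mul_one' P).symm ▸ ha.mem_source)

end IsCoordinateFamily

variable [NormedAddCommGroup V] [NormedSpace ℝ V] [ChartedSpace V G]
  {E : Type*} [NormedAddCommGroup E] [NormedSpace ℝ E] {φ : OpenPartialHomeomorph G V}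

theorem contMDiffAt_chart_symm_comp (hφ : φ ∈ IsManifold.maximalAtlas 𝓘(ℝ, V) ∞ G) {a : E → V}
    {x : E} (ha : ContDiffAt ℝ ∞ a x) (hx : a x ∈ φ.target) :
    ContMDiffAt 𝓘(ℝ, E) 𝓘(ℝ, V) ∞ (φ.symm ∘ a) x :=
  (contMDiffAt_symm_of_mem_maximalAtlas hφ hx).comp x ha.contMDiffAt

theorem contDiffAt_chart_comp (hφ : φ ∈ IsManifold.maximalAtlas 𝓘(ℝ, V) ∞ G) {A : E → G} {x : E}
    (hA : ContMDiffAt 𝓘(ℝ, E) 𝓘(ℝ, V) ∞ A x) (hx : A x ∈ φ.source) :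
    ContDiffAt ℝ ∞ (φ ∘ A) x :=
  ((contMDiffAt_of_mem_maximalAtlas hφ hx).comp x hA).contDiffAt

theorem contDiffAt_chartMul [Mul G] [ContMDiffMul 𝓘(ℝ, V) ∞ G]
    (hφ : φ ∈ IsManifold.maximalAtlas 𝓘(ℝ, V) ∞ G) {x y : V} (hx : x ∈ φ.target)
    (hy : y ∈ φ.target) (hxy : φ.symm x * φ.symm y ∈ φ.source) :
    ContDiffAt ℝ ∞ (chartMul φ) (x, y) :=
  contDiffAt_chart_comp hφ ((contMDiffAt_chart_symm_comp hφ contDiffAt_fst hx).mul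
    (contMDiffAt_chart_symm_comp hφ contDiffAt_snd hy)) hxy

variable [MoufangLoop G] [ContMDiffMul 𝓘(ℝ, V) ∞ G]

theorem isLocalMoufangLoop_chartMul (hφ : φ ∈ IsManifold.maximalAtlas 𝓘(ℝ, V) ∞ G)
    (hφ1 : (1 : G) ∈ φ.source) :
    IsLocalMoufangLoop (chartMul φ) ⟨φ.target, φ.open_target⟩ (φ 1) := by
  have := continuousMul_of_contMDiffMul 𝓘(ℝ, V) ∞ (G := G)
  have hfst := IsCoordinateFamily.symm_comp hφ1 (continuous_fst.tendsto (φ 1, φ 1))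
  have hsnd := IsCoordinateFamily.symm_comp hφ1 (continuous_snd.tendsto (φ 1, φ 1))
  have hconst {p : V} (hp : p ∈ φ.target) :
      IsCoordinateFamily φ (𝓝 (φ 1, φ 1)) (fun _ => p) (fun _ => φ.symm p) (φ.symm p) :=
    .symm_comp (φ.map_target hp) (by rw [φ.right_inv hp]; exact tendsto_const_nhds)
  exact
    { mem := φ.map_source hφ1
      contDiffAt_left := fun p hp => contDiffAt_chartMul hφ (φ.map_source hφ1) hp <| by
        simpa only [φ.left_inv hφ1, MoufangLoop.one_mul'] using φ.map_target hp
      contDiffAt_right := fun p hp => contDiffAt_chartMul hφ hp (φ.map_source hφ1) <| by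
        simpa only [φ.left_inv hφ1, MoufangLoop.mul_one'] using φ.map_target hp
      one_mul := fun p hp => by
        rw [chartMul, φ.left_inv hφ1, MoufangLoop.one_mul', φ.right_inv hp]
      mul_one := fun p hp => by
        rw [chartMul, φ.left_inv hφ1, MoufangLoop.mul_one', φ.right_inv hp]
      middle := fun p hp => ((hsnd.one_mul (hfst.one_mul (hconst hp))).mul_one hsnd)
        |>.eventuallyEq_of_eq ((hsnd.one_mul hfst).one_mul ((hconst hp).mul_one hsnd))
          fun z => MoufangLoop.mul_mul_mul_left _ _ _
      middle' := fun p hp => (hsnd.one_mul (((hconst hp).mul_one hfst).mul_one hsnd))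
        |>.eventuallyEq_of_eq ((hsnd.one_mul (hconst hp)).mul_one (hfst.one_mul hsnd))
          fun z => by rw [MoufangLoop.moufang', MoufangLoop.flexible]
      right := fun p hp => (((hfst.one_mul hsnd).one_mul (hconst hp)).mul_one hsnd)
        |>.eventuallyEq_of_eq (hfst.one_mul (hsnd.one_mul ((hconst hp).mul_one hsnd)))
          fun z => MoufangLoop.right_moufang _ _ _
      left := fun p hp => (hsnd.one_mul ((hconst hp).mul_one (hsnd.one_mul hfst)))
        |>.eventuallyEq_of_eq (((hsnd.one_mul (hconst hp)).mul_one hsnd).mul_one hfst)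
          fun z => MoufangLoop.left_moufang _ _ _ }

theorem contMDiffAt_chart_symm_commutator (hφ : φ ∈ IsManifold.maximalAtlas 𝓘(ℝ, V) ∞ G)
    (hφ1 : (1 : G) ∈ φ.source) (hinv : ContMDiff 𝓘(ℝ, V) 𝓘(ℝ, V) ∞ fun g : G => g⁻¹) :
    ContMDiffAt 𝓘(ℝ, V × V) 𝓘(ℝ, V) ∞ (fun z : V × V =>
      φ.symm z.1 * φ.symm z.2 * (φ.symm z.1)⁻¹ * (φ.symm z.2)⁻¹) (φ 1, φ 1) := by
  have hfst := contMDiffAt_chart_symm_comp hφ (contDiffAt_fst (p := (φ 1, φ 1)))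
    (φ.map_source hφ1)
  have hsnd := contMDiffAt_chart_symm_comp hφ (contDiffAt_snd (p := (φ 1, φ 1)))
    (φ.map_source hφ1)
  exact ((hfst.mul hsnd).mul (hinv.contMDiffAt.comp (φ 1, φ 1) hfst)).mul
    (hinv.contMDiffAt.comp (φ 1, φ 1) hsnd)

theorem contDiffAt_chartCommutator (hφ : φ ∈ IsManifold.maximalAtlas 𝓘(ℝ, V) ∞ G)
    (hφ1 : (1 : G) ∈ φ.source) (hinv : ContMDiff 𝓘(ℝ, V) 𝓘(ℝ, V) ∞ fun g : G => g⁻¹) :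
    ContDiffAt ℝ ∞ (chartCommutator φ) (φ 1, φ 1) :=
  contDiffAt_chart_comp hφ (contMDiffAt_chart_symm_commutator hφ hφ1 hinv) <| by
    simpa only [φ.left_inv hφ1, MoufangLoop.mul_inv_cancel_right', MoufangLoop.mul_inv'] using hφ1

theorem eventually_chartMul_chartCommutator (hφ : φ ∈ IsManifold.maximalAtlas 𝓘(ℝ, V) ∞ G)
    (hφ1 : (1 : G) ∈ φ.source) (hinv : ContMDiff 𝓘(ℝ, V) 𝓘(ℝ, V) ∞ fun g : G => g⁻¹) :
    ∀ᶠ z : V × V in 𝓝 (φ 1, φ 1),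
      chartMul φ (chartMul φ (chartCommutator φ z, z.2), z.1) = chartMul φ z := by
  have := continuousMul_of_contMDiffMul 𝓘(ℝ, V) ∞ (G := G)
  have hfst := IsCoordinateFamily.symm_comp hφ1 (continuous_fst.tendsto (φ 1, φ 1))
  have hsnd := IsCoordinateFamily.symm_comp hφ1 (continuous_snd.tendsto (φ 1, φ 1))
  have hcomm : IsCoordinateFamily φ (𝓝 (φ 1, φ 1)) (chartCommutator φ) _ 1 :=
    .of_tendsto hφ1 <| by
      simpa only [ContinuousAt, φ.left_inv hφ1, MoufangLoop.mul_inv_cancel_right',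
        MoufangLoop.mul_inv'] using (contMDiffAt_chart_symm_commutator hφ hφ1 hinv).continuousAt
  exact ((hcomm.one_mul hsnd).one_mul hfst).eventuallyEq_of_eq (hfst.one_mul hsnd) fun z => by
    simp only [Function.comp_apply, MoufangLoop.inv_mul_cancel_right']

theorem fderiv_fderiv_chartCommutator (hφ : φ ∈ IsManifold.maximalAtlas 𝓘(ℝ, V) ∞ G)
    (hφ1 : (1 : G) ∈ φ.source) (hinv : ContMDiff 𝓘(ℝ, V) 𝓘(ℝ, V) ∞ fun g : G => g⁻¹) (x y : V) :
    fderiv ℝ (fderiv ℝ (chartCommutator φ)) (φ 1, φ 1) (x, 0) (0, y) =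
      tangentProduct (chartMul φ) (φ 1) x y :=
  (isLocalMoufangLoop_chartMul hφ hφ1).fderiv_fderiv_commutator
    (contDiffAt_chartCommutator hφ hφ1 hinv)
    (.of_forall (chartCommutator_one_right hφ1))
    (eventually_chartMul_chartCommutator hφ hφ1 hinv) x y

end Chart

/-! ### Generators of birepresentations of smooth Moufang loops -/

section Generators

open Filter Topology

attribute [local instance] Matrix.linftyOpNormedRing Matrix.linftyOpNormedAlgebra
  LieRing.ofAssociativeRing

theorem differentiableAt_of_entries {E F ι κ : Type*} [NormedAddCommGroup E] [NormedSpace ℝ E]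
    [NormedAddCommGroup F] [NormedSpace ℝ F] [Finite ι] [Finite κ] {f : E → Matrix ι κ F}
    {x : E}
    (hf : ∀ i j, DifferentiableAt ℝ (fun y => f y i j) x) : DifferentiableAt ℝ f x := by
  cases nonempty_fintype ι
  cases nonempty_fintype κ
  exact differentiableAt_pi.2 fun i => differentiableAt_pi.2 (hf i)

theorem deriv_deriv_clm_comp {E F W Z : Type*} [NormedAddCommGroup E] [NormedSpace ℝ E]
    [NormedAddCommGroup F] [NormedSpace ℝ F] [NormedAddCommGroup W] [NormedSpace ℝ W]
    [NormedAddCommGroup Z] [NormedSpace ℝ Z] {f : E × F → W} {x : E} {y : F}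
    (hf : ContDiffAt ℝ 2 f (x, y)) (ℓ : W →L[ℝ] Z) (v : E) (w : F) :
    deriv (fun s : ℝ => deriv (fun t : ℝ => ℓ (f (x + s • v, y + t • w))) 0) 0 =
      ℓ (fderiv ℝ (fderiv ℝ f) (x, y) (v, 0) (0, w)) := by
  have hinner : (fun s : ℝ => deriv (fun t : ℝ => ℓ (f (x + s • v, y + t • w))) 0) =ᶠ[𝓝 0]
      fun s => ℓ (fderiv ℝ f ((x, y) + s • (v, 0)) (0, w)) := by
    have htendsto : Tendsto (fun s : ℝ => (x, y) + s • (v, (0 : F))) (𝓝 0) (𝓝 (x, y)) :=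
      Continuous.tendsto' (by fun_prop) _ _ (by simp)
    filter_upwards [htendsto.eventually (hf.eventually (by simp))] with s hs
    have hline := ((ℓ.hasFDerivAt.comp _ (hs.differentiableAt (by simp)).hasFDerivAt)
      |>.hasLineDerivAt (0, w)).lineDeriv
    simpa [lineDeriv] using hline
  have hfderiv : DifferentiableAt ℝ (fderiv ℝ f) (x, y) :=
    (hf.fderiv_right (m := 1) (by norm_num)).differentiableAt (by simp)
  have hline := ((ℓ.hasFDerivAt.comp _ (hfderiv.hasFDerivAt.clm_apply (hasFDerivAt_const (0, w) _)))
    |>.hasLineDerivAt (v, 0)).lineDeriv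
  rw [hinner.deriv_eq]
  simpa [lineDeriv] using hline

variable {r n : ℕ} {G : Type*} [TopologicalSpace G]
  {φ : OpenPartialHomeomorph G (EuclideanSpace ℝ (Fin r))} {S T : G → GL (Fin n) ℂ}

theorem coordPoint_eq_symm_add_smul [One G] (j : Fin r) (s : ℝ) :
    coordPoint φ j s = φ.symm (φ 1 + s • EuclideanSpace.single j 1) := by
  have hsingle : EuclideanSpace.single j s = s • EuclideanSpace.single j (1 : ℝ) := by
    ext i
    simp
  rw [coordPoint, hsingle]

theorem generator_eq_fderiv [One G]
    (hS : DifferentiableAt ℝ (fun y => (S (φ.symm y) : Matrix (Fin n) (Fin n) ℂ)) (φ 1))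
    (j : Fin r) : generator φ S j =
      fderiv ℝ (fun y => (S (φ.symm y) : Matrix (Fin n) (Fin n) ℂ)) (φ 1)
        (EuclideanSpace.single j 1) := by
  ext A B
  let entry : Matrix (Fin n) (Fin n) ℂ →L[ℝ] ℂ :=
    LinearMap.toContinuousLinearMap (Matrix.entryLinearMap ℝ ℂ A B)
  simp only [generator, Matrix.of_apply, coordPoint_eq_symm_add_smul]
  exact ((entry.hasFDerivAt.comp (φ 1) hS.hasFDerivAt).hasLineDerivAt
    (EuclideanSpace.single j 1)).lineDeriv

theorem linearCombination_generator [One G]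
    (hS : DifferentiableAt ℝ (fun y => (S (φ.symm y) : Matrix (Fin n) (Fin n) ℂ)) (φ 1)) :
    Fintype.linearCombination ℝ (generator φ S) =
      (fderiv ℝ (fun y => (S (φ.symm y) : Matrix (Fin n) (Fin n) ℂ)) (φ 1) :
        EuclideanSpace ℝ (Fin r) →ₗ[ℝ] Matrix (Fin n) (Fin n) ℂ) ∘ₗ
        (WithLp.linearEquiv 2 ℝ (Fin r → ℝ)).symm.toLinearMap := by
  refine LinearMap.pi_ext' fun j => LinearMap.ext_ring ?_
  simp only [LinearMap.comp_apply, LinearMap.coe_single, ContinuousLinearMap.coe_coe,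
    Fintype.linearCombination_apply_single, one_smul, generator_eq_fderiv hS]
  rfl

variable [ChartedSpace (EuclideanSpace ℝ (Fin r)) G]

theorem IsDifferentiableMap.differentiableAt_chart
    (hφ : φ ∈ IsManifold.maximalAtlas (𝓡 r) ∞ G) (hS : IsDifferentiableMap r S)
    {x : EuclideanSpace ℝ (Fin r)} (hx : x ∈ φ.target) :
    DifferentiableAt ℝ (fun y => (S (φ.symm y) : Matrix (Fin n) (Fin n) ℂ)) x := by
  have hsymm : MDifferentiableAt (𝓡 r) (𝓡 r) φ.symm x :=
    (contMDiffAt_symm_of_mem_maximalAtlas hφ hx).mdifferentiableAt (by simp)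
  exact differentiableAt_of_entries fun A B =>
    mdifferentiableAt_iff_differentiableAt.1 ((hS A B (φ.symm x)).comp x hsymm)

variable [MoufangLoop G] [ContMDiffMul (𝓡 r) ∞ G]

theorem structureConstant_eq_tangentProduct (hφ : φ ∈ IsManifold.maximalAtlas (𝓡 r) ∞ G)
    (hφ1 : (1 : G) ∈ φ.source) (hinv : ContMDiff (𝓡 r) (𝓡 r) ∞ fun g : G => g⁻¹)
    (i j k : Fin r) :
    structureConstant φ i j k = tangentProduct (chartMul φ) (φ 1)
      (EuclideanSpace.single j 1) (EuclideanSpace.single k 1) i := by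
  rw [← fderiv_fderiv_chartCommutator hφ hφ1 hinv]
  simp only [structureConstant, coordPoint_eq_symm_add_smul]
  exact deriv_deriv_clm_comp (contDiffAt_infty.1 (contDiffAt_chartCommutator hφ hφ1 hinv) 2)
    (EuclideanSpace.proj i) _ _

theorem symm_bracketOf_structureConstant (hφ : φ ∈ IsManifold.maximalAtlas (𝓡 r) ∞ G)
    (hφ1 : (1 : G) ∈ φ.source) (hinv : ContMDiff (𝓡 r) (𝓡 r) ∞ fun g : G => g⁻¹)
    (x y : Fin r → ℝ) :
    (WithLp.linearEquiv 2 ℝ (Fin r → ℝ)).symm (bracketOf (structureConstant φ) x y) =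
      tangentProduct (chartMul φ) (φ 1) ((WithLp.linearEquiv 2 ℝ (Fin r → ℝ)).symm x)
        ((WithLp.linearEquiv 2 ℝ (Fin r → ℝ)).symm y) := by
  let ι := (WithLp.linearEquiv 2 ℝ (Fin r → ℝ)).symm
  suffices h : (bracketLinear (structureConstant φ)).compr₂ ι.toLinearMap =
      (tangentProduct (chartMul φ) (φ 1)).compl₁₂ ι.toLinearMap ι.toLinearMap from
    LinearMap.congr_fun₂ h x y
  refine LinearMap.pi_ext' fun j => LinearMap.ext_ring (LinearMap.pi_ext' fun k =>
    LinearMap.ext_ring ?_)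
  ext i
  simp only [LinearMap.comp_apply, LinearMap.compr₂_apply, LinearMap.compl₁₂_apply,
    LinearMap.coe_single, bracketLinear_single_single]
  exact structureConstant_eq_tangentProduct hφ hφ1 hinv i j k

theorem isMaltsevBracket_structureConstant (hφ : φ ∈ IsManifold.maximalAtlas (𝓡 r) ∞ G)
    (hφ1 : (1 : G) ∈ φ.source) (hinv : ContMDiff (𝓡 r) (𝓡 r) ∞ fun g : G => g⁻¹) :
    IsMaltsevBracket (bracketOf (structureConstant φ)) :=
  .of_injective (isLocalMoufangLoop_chartMul hφ hφ1).isMaltsevBracket_tangentProduct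
    (WithLp.linearEquiv 2 ℝ (Fin r → ℝ)).symm (LinearEquiv.injective _)
    (symm_bracketOf_structureConstant hφ hφ1 hinv)

theorem isLocalBirepresentation_chart (hφ : φ ∈ IsManifold.maximalAtlas (𝓡 r) ∞ G)
    (hφ1 : (1 : G) ∈ φ.source) (hST : IsBirepresentation S T) (hS : IsDifferentiableMap r S)
    (hT : IsDifferentiableMap r T) :
    IsLocalBirepresentation (chartMul φ) (φ 1)
      (fun y => (S (φ.symm y) : Matrix (Fin n) (Fin n) ℂ))
      (fun y => (T (φ.symm y) : Matrix (Fin n) (Fin n) ℂ)) := by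
  have := continuousMul_of_contMDiffMul (𝓡 r) ∞ (G := G)
  have hfst := IsCoordinateFamily.symm_comp hφ1 (continuous_fst.tendsto (φ 1, φ 1))
  have hsnd := IsCoordinateFamily.symm_comp hφ1 (continuous_snd.tendsto (φ 1, φ 1))
  have hfst_snd : ∀ᶠ z in 𝓝 (φ 1, φ 1),
      φ.symm (chartMul φ (z.1, z.2)) = φ.symm z.1 * φ.symm z.2 :=
    (hfst.one_mul hsnd).eventually_symm_eq
  have hsnd_fst : ∀ᶠ z in 𝓝 (φ 1, φ 1),
      φ.symm (chartMul φ (z.2, z.1)) = φ.symm z.2 * φ.symm z.1 :=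
    (hsnd.one_mul hfst).eventually_symm_eq
  have htarget := φ.open_target.mem_nhds (φ.map_source hφ1)
  have coe {A B : GL (Fin n) ℂ} (h : A = B) :
      (A : Matrix (Fin n) (Fin n) ℂ) = (B : Matrix (Fin n) (Fin n) ℂ) := congrArg _ h
  exact
    { left_one := by rw [φ.left_inv hφ1, hST.left_one, Units.val_one]
      right_one := by rw [φ.left_inv hφ1, hST.right_one, Units.val_one]
      left_differentiable := by
        filter_upwards [htarget] with q hq using
          hS.differentiableAt_chart hφ hq
      right_differentiable := by
        filter_upwards [htarget] with q hq using
          hT.differentiableAt_chart hφ hq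
      left_mul := hsnd_fst.mono fun z hz => by rw [hz]; exact coe (hST.left_mul _ _)
      left_mul' := hfst_snd.mono fun z hz => by rw [hz]; exact coe (hST.right_mul_left _ _)
      right_mul := hfst_snd.mono fun z hz => by rw [hz]; exact coe (hST.right_mul _ _)
      right_mul' := hsnd_fst.mono fun z hz => by rw [hz]; exact coe (hST.left_mul_right _ _) }

theorem IsBirepresentation.isTranslationPair (hST : IsBirepresentation S T)
    (hS : IsDifferentiableMap r S) (hT : IsDifferentiableMap r T)
    (hφ : φ ∈ IsManifold.maximalAtlas (𝓡 r) ∞ G) (hφ1 : (1 : G) ∈ φ.source)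
    (hinv : ContMDiff (𝓡 r) (𝓡 r) ∞ fun g : G => g⁻¹) :
    IsTranslationPair (bracketLinear (structureConstant φ))
      (Fintype.linearCombination ℝ (generator φ S))
      (Fintype.linearCombination ℝ (generator φ T)) := by
  have he : φ 1 ∈ φ.target := φ.map_source hφ1
  rw [linearCombination_generator (hS.differentiableAt_chart hφ he),
    linearCombination_generator (hT.differentiableAt_chart hφ he)]
  exact ((isLocalBirepresentation_chart hφ hφ1 hST hS hT).isTranslationPair
    (isLocalMoufangLoop_chartMul hφ hφ1)).comp _ (symm_bracketOf_structureConstant hφ hφ1 hinv)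

end Generators

instance IsAnalyticMoufangLoop.contMDiffMul {r : ℕ} {G : Type*} [TopologicalSpace G]
    [ChartedSpace (EuclideanSpace ℝ (Fin r)) G] [MoufangLoop G] [IsAnalyticMoufangLoop r G] :
    ContMDiffMul (𝓡 r) ω G where
  contMDiff_mul := IsAnalyticMoufangLoop.contMDiff_mul'

end

theorem mainTheorem1_general {r n m : ℕ} {G : Type*} [TopologicalSpace G]
    [ChartedSpace (EuclideanSpace ℝ (Fin r)) G] [MoufangLoop G] [ContMDiffMul (𝓡 r) ∞ G]
    (hinv : ContMDiff (𝓡 r) (𝓡 r) ∞ fun g : G => g⁻¹)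
    (φ : OpenPartialHomeomorph G (EuclideanSpace ℝ (Fin r)))
    (hφ : φ ∈ IsManifold.maximalAtlas (𝓡 r) ∞ G) (hφ1 : (1 : G) ∈ φ.source)
    (S T : G → GL (Fin n) ℂ) (hST : IsBirepresentation S T)
    (hS : IsDifferentiableMap r S) (hT : IsDifferentiableMap r T)
    {D : Type*} [NormedAddCommGroup D] [InnerProductSpace ℂ D]
    (stat : FieldStatistics) (u p : Fin n → OperatorField m D) (hETC : CanonicalETC stat u p)
    (K : ℕ → SplittingKernel m) (hK : IsDeltaSequence K) (σ τ : Fin r → Module.End ℂ D)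
    (hσ : ∀ j, IsNoetherCharge K p (generator φ S j) u (σ j))
    (hτ : ∀ j, IsNoetherCharge K p (generator φ T j) u (τ j)) :
    IsMaltsevBirepresentation (structureConstant φ) σ τ
      (yamagutian (structureConstant φ) σ τ) := by
  have hmaltsev := isMaltsevBracket_structureConstant hφ hφ1 hinv
  have hgenerators := hST.isTranslationPair hS hT hφ hφ1 hinv
  have hcharges := hgenerators.of_charges hETC hK hσ hτ
  exact hcharges.isMaltsevBirepresentation hmaltsev

theorem mainTheorem1 {r n m : ℕ} {G : Type*} [TopologicalSpace G]
    [ChartedSpace (EuclideanSpace ℝ (Fin r)) G] [MoufangLoop G] [IsAnalyticMoufangLoop r G]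
    (φ : OpenPartialHomeomorph G (EuclideanSpace ℝ (Fin r)))
    (hφ : φ ∈ IsManifold.maximalAtlas (𝓡 r) ω G) (hφ1 : (1 : G) ∈ φ.source)
    (S T : G → GL (Fin n) ℂ) (hST : IsBirepresentation S T)
    (hS : IsDifferentiableMap r S) (hT : IsDifferentiableMap r T)
    {D : Type*} [NormedAddCommGroup D] [InnerProductSpace ℂ D]
    (stat : FieldStatistics) (u p : ℝ → Fin n → OperatorField m D)
    (hETC : ∀ t, CanonicalETC stat (u t) (p t))
    (K : ℕ → SplittingKernel m) (hK : IsDeltaSequence K)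
    (t : ℝ) (σ τ : Fin r → Module.End ℂ D)
    (hσ : ∀ j, IsNoetherCharge K (p t) (generator φ S j) (u t) (σ j))
    (hτ : ∀ j, IsNoetherCharge K (p t) (generator φ T j) (u t) (τ j)) :
    IsMaltsevBirepresentation (structureConstant φ) σ τ
      (yamagutian (structureConstant φ) σ τ) :=
  mainTheorem1_general (IsAnalyticMoufangLoop.contMDiff_inv'.of_le le_top) φ
    (IsManifold.maximalAtlas_subset_of_le le_top hφ) hφ1 S T hST hS hT stat (u t) (p t) (hETC t)
    K hK σ τ hσ hτ
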